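/- Let $f:\mathbb R^d\times\mathbb R^d\times\mathbb R\times\mathbb R^{n_f}\to\mathbb R^d$ be $C^1$ with $(x,v,t)\mapsto\partial f/\partial v(x,v,t,\theta_f)$ differentiable, let $g:\mathbb R^d\times\mathbb R^{n_g}\to\mathbb R^d$, $s(X_0,\cdot):\mathbb R^{n_s}\to\mathbb R^d$ and the loss $L:\mathbb R^d\times\mathbb R^d\to\mathbb R$ be differentiable, let $t_0<t_n$, and let $x$, with $v=\dot x$, solve on $[t_0,t_n]$ the second order neural ODE $$\ddot x=f(x,\dot x,t,\theta_f),\qquad x(t_0)=s(X_0,\theta_s),\qquad \dot x(t_0)=g(x(t_0),\theta_g),$$ with loss $L(x(t_n),\dot x(t_n))$. Derivatives of $f$ are taken along the trajectory, and all gradients are row vectors. *Second order adjoint method.* The second order adjoint $\rho$ satisfies on $[t_0,t_n]$ $$\ddot\rho=\rho^T\frac{\partial f}{\partial x}-\dot\rho^T\frac{\partial f}{\partial v}-\rho^T\frac{d}{dt}\Big(\frac{\partial f}{\partial v}\Big),\qquad \rho(t_n)=\frac{\partial L}{\partial v(t_n)},\qquad \dot\rho(t_n)=-\frac{\partial L}{\partial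 x(t_n)}-\frac{\partial L}{\partial v(t_n)^T}\frac{\partial f}{\partial v}\Big|_{t_n},$$ and the method returns $$\frac{dL}{d\theta_f}=-\int_{t_n}^{t_0}\rho^T\frac{\partial f}{\partial\theta_f}\,dt,\qquad \frac{dL}{d\theta_g}=\rho(t_0)^T\frac{\partial g}{\partial\theta_g},\qquad \frac{dL}{d\theta_s}=\Big(\rho(t_0)^T\frac{\partial g}{\partial x(t_0)}-\dot\rho(t_0)^T-\rho(t_0)^T\frac{\partial f}{\partial v}\Big|_{t_0}\Big)\frac{ds}{d\theta_s}.$$ *First order adjoint method.* For a system $\dot z=F(z,t,\theta_f)$, $z(t_0)=S(X_0,\tilde\theta_s)$ with loss $\ell(z(t_n))$, the adjoint satisfies $\dot r=-r^T\,\partial F/\partial z$ on $[t_0,t_n]$, $r(t_n)=\partial \ell/\partial z(t_n)$, and the method returns $dL/d\theta_f=-\int_{t_n}^{t_0}r^T\,\partial F/\partial\theta_f\,dt$ and $dL/d\tilde\theta_s=r(t_0)^T\,dS/d\tilde\theta_s$. Apply it to the coupled system $z=[x,v]$, $F=[v,f(x,v,t,\theta_f)]$, $S=[s(X_0,\theta_s),\,g(s(X_0,\theta_s),\theta_g)]$,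 $\tilde\theta_s=[\theta_s,\theta_g]$, $\ell(z)=L(x,v)$; $z=[x,v]$ is a solution of it. Write $r=[r^A,r^B]$. Then: 1. The total derivative $\frac{d}{dt}(\partial f/\partial v)$ exists along the trajectory and is the derivative of $\partial f/\partial v$ at $(x,v,t)$ in the direction $(v,f,1)$. For every first order adjoint $r=[r^A,r^B]$ the block $r^B$ satisfies the differential equation and the terminal conditions of the second order adjoint, with $\dot r^B=-r^A-(r^B)^T\,\partial f/\partial v$. Conversely, if $\rho$ is a second order adjoint, then $[-\dot\rho-\rho^T\,\partial f/\partial v,\ \rho]$ is a first order adjoint. Any first order adjoint $r$ and any second order adjoint $\rho$ satisfy $r^B=\rho$ on $[t_0,t_n]$. 2. The gradients with respect to $\theta_f$, $\theta_g$ and $\theta_s$ returned by the two methods coincide (the integrals exist). 3. The second order method, run with stored state $[\rho,\dot\rho]$, requires at least as many matrix multiplications as the first order method, run with stored state $[r^A,r^B]$. This holds separately for the terminal conditions, for each evaluation of the time derivative of the stored state, for the integrand of $dL/d\theta_f$, for $dL/d\theta_g$ and for $dL/d\theta_s$, and for a whole backward pass with any number of evaluations. It holds for the formulas as displayed above (the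 first order method being $\dot r^A=-(r^B)^T\partial f/\partial x$, $\dot r^B=-r^A-(r^B)^T\partial f/\partial v$, with integrand $(r^B)^T\partial f/\partial\theta_f$ and gradients $dL/d\theta_g=r^B(t_0)^T\partial g/\partial\theta_g$, $dL/d\theta_s=(r^A(t_0)^T+r^B(t_0)^T\,\partial g/\partial x(t_0))\,ds/d\theta_s$). Moreover, for each set $Z$ of the derivatives $\partial L/\partial x,\partial L/\partial v,\partial f/\partial x,\partial f/\partial v,\frac{d}{dt}(\partial f/\partial v),\partial f/\partial\theta_f,\partial g/\partial x,\partial g/\partial\theta_g,ds/d\theta_s$ that may be known to vanish ($Z=\emptyset$ being the general case), every way of computing the quantities of the second order method by matrix expressions (sums, differences, scalar multiples and products of the stored row vectors and these derivatives, correct for all values of them for which the members of $Z$ are zero) uses at least as many products as some way of computing the quantities of the first order method by such expressions. -/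

import Mathlib

open scoped Matrix

namespace SONODE

noncomputable section

/-! ### Jacobians -/

/-- The gradient (as a row vector) `(∂L/∂y_j)_j` of a scalar function at `y`. -/
def grad {κ : Type*} [Fintype κ] [DecidableEq κ] (L : (κ → ℝ) → ℝ) (y : κ → ℝ) : κ → ℝ :=
  fun j => fderiv ℝ L y (Pi.single j 1)

/-- The Jacobian matrix `(∂F_i/∂y_j)_{i,j}` of a vector function at `y`. -/
def jac {ι κ : Type*} [Fintype ι] [Fintype κ] [DecidableEq κ]
    (F : (κ → ℝ) → (ι → ℝ)) (y : κ → ℝ) : Matrix ι κ ℝ :=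
  Matrix.of fun i j => fderiv ℝ F y (Pi.single j 1) i

/-! ### First order neural ODEs and the first order adjoint method -/

/-- A first order neural ODE `ż = f(z, t, θ_f)`, `z(t₀) = s(X₀, θ_s)`, with a scalar loss
`L(z(tₙ))`. The state has coordinates indexed by `ι`, the parameters `θ_f` by `φ` and the
parameters `θ_s` by `σ`. -/
structure FirstOrderModel (𝒳 ι φ σ : Type*) where
  field : (ι → ℝ) → ℝ → (φ → ℝ) → (ι → ℝ)
  init : 𝒳 → (σ → ℝ) → (ι → ℝ)
  loss : (ι → ℝ) → ℝ

/-- The concatenation `[x, v]` of two curves in `ℝᵈ`, a curve in `ℝ²ᵈ`. -/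
def concat {d : ℕ} (x v : ℝ → Fin d → ℝ) : ℝ → Fin d ⊕ Fin d → ℝ :=
  fun t => Sum.elim (x t) (v t)

namespace FirstOrderModel

variable {𝒳 ι φ σ : Type*} [Fintype ι] [DecidableEq ι] [Fintype φ] [DecidableEq φ]
  [Fintype σ] [DecidableEq σ] (N : FirstOrderModel 𝒳 ι φ σ)

/-- `z` solves the neural ODE on `[t₀, tₙ]`. -/
structure IsTrajectory (X₀ : 𝒳) (θf : φ → ℝ) (θs : σ → ℝ) (t₀ tₙ : ℝ) (z : ℝ → ι → ℝ) :
    Prop where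
  initial : z t₀ = N.init X₀ θs
  ode : ∀ t ∈ Set.Icc t₀ tₙ, HasDerivWithinAt z (N.field (z t) t θf) (Set.Icc t₀ tₙ) t

/-- `r` is the first order adjoint along `z`:
`ṙ = -rᵀ ∂f/∂z` on `[t₀, tₙ]` and `r(tₙ) = ∂L/∂z(tₙ)`. -/
structure IsAdjoint (θf : φ → ℝ) (t₀ tₙ : ℝ) (z r : ℝ → ι → ℝ) : Prop where
  terminal : r tₙ = grad N.loss (z tₙ)
  ode : ∀ t ∈ Set.Icc t₀ tₙ,
    HasDerivWithinAt r (-(r t ᵥ* jac (fun y => N.field y t θf) (z t))) (Set.Icc t₀ tₙ) t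

/-- The integrand `rᵀ ∂f/∂θ_f`. -/
def gradFieldIntegrand (θf : φ → ℝ) (z r : ℝ → ι → ℝ) (t : ℝ) : φ → ℝ :=
  r t ᵥ* jac (fun θ => N.field (z t) t θ) θf

/-- The first order adjoint method's `dL/dθ_f = -∫_{tₙ}^{t₀} rᵀ ∂f/∂θ_f dt`. -/
def gradField (θf : φ → ℝ) (t₀ tₙ : ℝ) (z r : ℝ → ι → ℝ) : φ → ℝ :=
  -∫ t in tₙ..t₀, N.gradFieldIntegrand θf z r t

/-- The first order adjoint method's `dL/dθ_s = r(t₀)ᵀ ds/dθ_s`. -/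
def gradInit (X₀ : 𝒳) (θs : σ → ℝ) (t₀ : ℝ) (r : ℝ → ι → ℝ) : σ → ℝ :=
  r t₀ ᵥ* jac (fun θ => N.init X₀ θ) θs

end FirstOrderModel

/-! ### Second order neural ODEs and the second order adjoint method -/

/-- A second order neural ODE `ẍ = f(x, ẋ, t, θ_f)`, `x(t₀) = s(X₀, θ_s)`,
`ẋ(t₀) = g(x(t₀), θ_g)` on `ℝᵈ`, with a scalar loss `L(x(tₙ), ẋ(tₙ))`. Here `acc = f`,
`vel = g`, `pos = s`, and `θ_f, θ_g, θ_s` have `nf, ng, ns` coordinates. -/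
structure SecondOrderModel (𝒳 : Type*) (d nf ng ns : ℕ) where
  acc : (Fin d → ℝ) → (Fin d → ℝ) → ℝ → (Fin nf → ℝ) → (Fin d → ℝ)
  vel : (Fin d → ℝ) → (Fin ng → ℝ) → (Fin d → ℝ)
  pos : 𝒳 → (Fin ns → ℝ) → (Fin d → ℝ)
  loss : (Fin d → ℝ) → (Fin d → ℝ) → ℝ

namespace SecondOrderModel

variable {𝒳 : Type*} {d nf ng ns : ℕ} (M : SecondOrderModel 𝒳 d nf ng ns)

/-- The coupled first order system `z = [x, v]`, `ż = [v, f(x, v, t, θ_f)]`,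
`z(t₀) = [s(X₀, θ_s), g(s(X₀, θ_s), θ_g)]`. Its initial parameters are `[θ_s, θ_g]`. -/
def coupled :
    FirstOrderModel 𝒳 (Fin d ⊕ Fin d) (Fin nf) (Fin ns ⊕ Fin ng) where
  field z t θ := Sum.elim (z ∘ Sum.inr) (M.acc (z ∘ Sum.inl) (z ∘ Sum.inr) t θ)
  init X₀ θ := Sum.elim (M.pos X₀ (θ ∘ Sum.inl)) (M.vel (M.pos X₀ (θ ∘ Sum.inl)) (θ ∘ Sum.inr))
  loss z := M.loss (z ∘ Sum.inl) (z ∘ Sum.inr)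

/-- `x`, with velocity `v = ẋ`, solves the second order neural ODE on `[t₀, tₙ]`. -/
structure IsTrajectory (X₀ : 𝒳) (θf : Fin nf → ℝ) (θg : Fin ng → ℝ) (θs : Fin ns → ℝ)
    (t₀ tₙ : ℝ) (x v : ℝ → Fin d → ℝ) : Prop where
  initial_pos : x t₀ = M.pos X₀ θs
  initial_vel : v t₀ = M.vel (x t₀) θg
  velocity : ∀ t ∈ Set.Icc t₀ tₙ, HasDerivWithinAt x (v t) (Set.Icc t₀ tₙ) t
  ode : ∀ t ∈ Set.Icc t₀ tₙ, HasDerivWithinAt v (M.acc (x t) (v t) t θf) (Set.Icc t₀ tₙ) t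

/-- `∂L/∂x` at a point. -/
def lossPos (x v : Fin d → ℝ) : Fin d → ℝ := grad (fun y => M.loss y v) x

/-- `∂L/∂ẋ` at a point. -/
def lossVel (x v : Fin d → ℝ) : Fin d → ℝ := grad (fun y => M.loss x y) v

/-- `∂f/∂x` at a point. -/
def accPos (θf : Fin nf → ℝ) (x v : Fin d → ℝ) (t : ℝ) : Matrix (Fin d) (Fin d) ℝ :=
  jac (fun y => M.acc y v t θf) x

/-- `∂f/∂ẋ` at a point. -/
def accVel (θf : Fin nf → ℝ) (x v : Fin d → ℝ) (t : ℝ) : Matrix (Fin d) (Fin d) ℝ :=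
  jac (fun y => M.acc x y t θf) v

/-- `∂f/∂θ_f` at a point. -/
def accPar (θf : Fin nf → ℝ) (x v : Fin d → ℝ) (t : ℝ) : Matrix (Fin d) (Fin nf) ℝ :=
  jac (fun θ => M.acc x v t θ) θf

/-- `∂g/∂x` at a point. -/
def velPos (θg : Fin ng → ℝ) (x : Fin d → ℝ) : Matrix (Fin d) (Fin d) ℝ :=
  jac (fun y => M.vel y θg) x

/-- `∂g/∂θ_g` at a point. -/
def velPar (θg : Fin ng → ℝ) (x : Fin d → ℝ) : Matrix (Fin d) (Fin ng) ℝ :=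
  jac (fun θ => M.vel x θ) θg

/-- `∂s/∂θ_s`. -/
def posPar (X₀ : 𝒳) (θs : Fin ns → ℝ) : Matrix (Fin d) (Fin ns) ℝ :=
  jac (fun θ => M.pos X₀ θ) θs

/-- The total time derivative `d/dt (∂f/∂ẋ)` along the trajectory `(x, v)` on `[t₀, tₙ]`. -/
def accVelDot (θf : Fin nf → ℝ) (t₀ tₙ : ℝ) (x v : ℝ → Fin d → ℝ) (t : ℝ) :
    Matrix (Fin d) (Fin d) ℝ :=
  Matrix.of fun i j =>
    derivWithin (fun τ => M.accVel θf (x τ) (v τ) τ i j) (Set.Icc t₀ tₙ) t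

/-- `r`, with `w = ṙ`, is the second order adjoint along `(x, v)`:
`r̈ = rᵀ ∂f/∂x - ṙᵀ ∂f/∂ẋ - rᵀ d/dt(∂f/∂ẋ)` on `[t₀, tₙ]`, with
`r(tₙ) = ∂L/∂ẋ(tₙ)` and `ṙ(tₙ) = -∂L/∂x(tₙ) - (∂L/∂ẋ(tₙ))ᵀ ∂f/∂ẋ|_{tₙ}`. -/
structure IsAdjoint (θf : Fin nf → ℝ) (t₀ tₙ : ℝ) (x v r w : ℝ → Fin d → ℝ) : Prop where
  terminal : r tₙ = M.lossVel (x tₙ) (v tₙ)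
  terminal_deriv : w tₙ = -M.lossPos (x tₙ) (v tₙ)
    - M.lossVel (x tₙ) (v tₙ) ᵥ* M.accVel θf (x tₙ) (v tₙ) tₙ
  deriv : ∀ t ∈ Set.Icc t₀ tₙ, HasDerivWithinAt r (w t) (Set.Icc t₀ tₙ) t
  ode : ∀ t ∈ Set.Icc t₀ tₙ, HasDerivWithinAt w
    (r t ᵥ* M.accPos θf (x t) (v t) t - w t ᵥ* M.accVel θf (x t) (v t) t
      - r t ᵥ* M.accVelDot θf t₀ tₙ x v t) (Set.Icc t₀ tₙ) t

/-- The integrand `rᵀ ∂f/∂θ_f`. -/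
def gradAccIntegrand (θf : Fin nf → ℝ) (x v r : ℝ → Fin d → ℝ) (t : ℝ) : Fin nf → ℝ :=
  r t ᵥ* M.accPar θf (x t) (v t) t

/-- The second order adjoint method's `dL/dθ_f = -∫_{tₙ}^{t₀} rᵀ ∂f/∂θ_f dt`. -/
def gradAcc (θf : Fin nf → ℝ) (t₀ tₙ : ℝ) (x v r : ℝ → Fin d → ℝ) : Fin nf → ℝ :=
  -∫ t in tₙ..t₀, M.gradAccIntegrand θf x v r t

/-- The second order adjoint method's `dL/dθ_g = r(t₀)ᵀ ∂g/∂θ_g`. -/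
def gradVel (θg : Fin ng → ℝ) (t₀ : ℝ) (x r : ℝ → Fin d → ℝ) : Fin ng → ℝ :=
  r t₀ ᵥ* M.velPar θg (x t₀)

/-- The second order adjoint method's
`dL/dθ_s = (r(t₀)ᵀ ∂g/∂x(t₀) - ṙ(t₀)ᵀ - r(t₀)ᵀ ∂f/∂ẋ|_{t₀}) ds/dθ_s`. -/
def gradPos (X₀ : 𝒳) (θf : Fin nf → ℝ) (θg : Fin ng → ℝ) (θs : Fin ns → ℝ) (t₀ : ℝ)
    (x v r w : ℝ → Fin d → ℝ) : Fin ns → ℝ :=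
  (r t₀ ᵥ* M.velPos θg (x t₀) - w t₀ - r t₀ ᵥ* M.accVel θf (x t₀) (v t₀) t₀)
    ᵥ* M.posPar X₀ θs

end SecondOrderModel

/-! ### Counting matrix multiplications -/

/-- The possible numbers of rows and columns: `1`, `d`, `nf`, `ng`, `ns`. -/
inductive Shape
  | unit
  | state
  | accPar
  | velPar
  | posPar

/-- The numerical value of a shape. -/
def Shape.size (d nf ng ns : ℕ) : Shape → ℕ
  | .unit => 1
  | .state => d
  | .accPar => nf
  | .velPar => ng
  | .posPar => ns

/-- The first derivatives (and the total time derivative of `∂f/∂ẋ`) that backpropagation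
supplies to an adjoint method. -/
inductive Datum : Shape → Shape → Type
  | lossPos : Datum .unit .state
  | lossVel : Datum .unit .state
  | accPos : Datum .state .state
  | accVel : Datum .state .state
  | accVelDot : Datum .state .state
  | accPar : Datum .state .accPar
  | velPos : Datum .state .state
  | velPar : Datum .state .velPar
  | posPar : Datum .state .posPar

/-- Matrix expressions in the derivatives and in the two halves `fst`, `snd` (row vectors in
`ℝᵈ`) of the adjoint state that a method stores. Row vectors are matrices with one row. -/
inductive MatExpr : Shape → Shape → Type
  | fst : MatExpr .unit .state
  | snd : MatExpr .unit .state
  | datum {a b : Shape} : Datum a b → MatExpr a b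
  | zero {a b : Shape} : MatExpr a b
  | add {a b : Shape} : MatExpr a b → MatExpr a b → MatExpr a b
  | sub {a b : Shape} : MatExpr a b → MatExpr a b → MatExpr a b
  | neg {a b : Shape} : MatExpr a b → MatExpr a b
  | smul {a b : Shape} : ℝ → MatExpr a b → MatExpr a b
  | mul {a b c : Shape} : MatExpr a b → MatExpr b c → MatExpr a c

/-- Numerical values of the derivatives. -/
abbrev Valuation (d nf ng ns : ℕ) : Type :=
  (a b : Shape) → Datum a b →
    Matrix (Fin (a.size d nf ng ns)) (Fin (b.size d nf ng ns)) ℝ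

namespace MatExpr

/-- The value of an expression. -/
def eval {d nf ng ns : ℕ} (D : Valuation d nf ng ns) (p q : Fin d → ℝ) :
    {a b : Shape} → MatExpr a b →
      Matrix (Fin (a.size d nf ng ns)) (Fin (b.size d nf ng ns)) ℝ
  | _, _, fst => Matrix.of fun _ j => p j
  | _, _, snd => Matrix.of fun _ j => q j
  | _, _, datum s => D _ _ s
  | _, _, zero => 0
  | _, _, add e₁ e₂ => eval D p q e₁ + eval D p q e₂
  | _, _, sub e₁ e₂ => eval D p q e₁ - eval D p q e₂
  | _, _, neg e => -eval D p q e
  | _, _, smul c e => c • eval D p q e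
  | _, _, mul e₁ e₂ => eval D p q e₁ * eval D p q e₂

/-- The value of a one-row expression, as a vector. -/
def row {d nf ng ns : ℕ} (D : Valuation d nf ng ns) (p q : Fin d → ℝ) {b : Shape}
    (e : MatExpr .unit b) : Fin (b.size d nf ng ns) → ℝ :=
  fun j => eval D p q e (0 : Fin 1) j

/-- The number of matrix multiplications in an expression. -/
def mulCount : {a b : Shape} → MatExpr a b → ℕ
  | _, _, fst => 0
  | _, _, snd => 0
  | _, _, datum _ => 0
  | _, _, zero => 0
  | _, _, add e₁ e₂ => mulCount e₁ + mulCount e₂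
  | _, _, sub e₁ e₂ => mulCount e₁ + mulCount e₂
  | _, _, neg e => mulCount e
  | _, _, smul _ e => mulCount e
  | _, _, mul e₁ e₂ => mulCount e₁ + mulCount e₂ + 1

end MatExpr

/-- A scheme for running an adjoint method backwards in time with a stored adjoint state
consisting of two row vectors in `ℝᵈ`: the expressions for the terminal values of the two halves,
for their time derivatives, for the integrand of `-dL/dθ_f`, and for `dL/dθ_g`, `dL/dθ_s`
at `t₀`. -/
structure Scheme where
  terminal₁ : MatExpr .unit .state
  terminal₂ : MatExpr .unit .state
  rhs₁ : MatExpr .unit .state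
  rhs₂ : MatExpr .unit .state
  gradAcc : MatExpr .unit .accPar
  gradVel : MatExpr .unit .velPar
  gradPos : MatExpr .unit .posPar

namespace Scheme

open MatExpr Datum

/-- The first order adjoint method on the coupled system; the stored state is `[r^A, r^B]`. -/
def firstOrder : Scheme where
  terminal₁ := .datum lossPos
  terminal₂ := .datum lossVel
  rhs₁ := .neg (.mul .snd (.datum accPos))
  rhs₂ := .sub (.neg .fst) (.mul .snd (.datum accVel))
  gradAcc := .mul .snd (.datum accPar)
  gradVel := .mul .snd (.datum velPar)
  gradPos := .mul (.add .fst (.mul .snd (.datum velPos))) (.datum posPar)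

/-- The second order adjoint method; the stored state is `[r, ṙ]`. -/
def secondOrder : Scheme where
  terminal₁ := .datum lossVel
  terminal₂ := .sub (.neg (.datum lossPos)) (.mul (.datum lossVel) (.datum accVel))
  rhs₁ := .snd
  rhs₂ := .sub (.sub (.mul .fst (.datum accPos)) (.mul .snd (.datum accVel)))
    (.mul .fst (.datum accVelDot))
  gradAcc := .mul .fst (.datum accPar)
  gradVel := .mul .fst (.datum velPar)
  gradPos := .mul (.sub (.sub (.mul .fst (.datum velPos)) .snd) (.mul .fst (.datum accVel)))
    (.datum posPar)

/-- `p, q` are the two halves of the adjoint state that the scheme produces on `[t₀, tₙ]`. -/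
structure IsRun (S : Scheme) {d nf ng ns : ℕ} (D : ℝ → Valuation d nf ng ns) (t₀ tₙ : ℝ)
    (p q : ℝ → Fin d → ℝ) : Prop where
  terminal₁ : p tₙ = S.terminal₁.row (D tₙ) (p tₙ) (q tₙ)
  terminal₂ : q tₙ = S.terminal₂.row (D tₙ) (p tₙ) (q tₙ)
  ode₁ : ∀ t ∈ Set.Icc t₀ tₙ,
    HasDerivWithinAt p (S.rhs₁.row (D t) (p t) (q t)) (Set.Icc t₀ tₙ) t
  ode₂ : ∀ t ∈ Set.Icc t₀ tₙ,
    HasDerivWithinAt q (S.rhs₂.row (D t) (p t) (q t)) (Set.Icc t₀ tₙ) t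

/-- Two schemes compute the same quantities whenever the derivatives in `Z` vanish. -/
structure Computes (d nf ng ns : ℕ) (Z : (a b : Shape) → Set (Datum a b)) (T S : Scheme) :
    Prop where
  terminal₁ : ∀ (D : Valuation d nf ng ns) p q, (∀ a b, ∀ s ∈ Z a b, D a b s = 0) →
    T.terminal₁.eval D p q = S.terminal₁.eval D p q
  terminal₂ : ∀ (D : Valuation d nf ng ns) p q, (∀ a b, ∀ s ∈ Z a b, D a b s = 0) →
    T.terminal₂.eval D p q = S.terminal₂.eval D p q
  rhs₁ : ∀ (D : Valuation d nf ng ns) p q, (∀ a b, ∀ s ∈ Z a b, D a b s = 0) →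
    T.rhs₁.eval D p q = S.rhs₁.eval D p q
  rhs₂ : ∀ (D : Valuation d nf ng ns) p q, (∀ a b, ∀ s ∈ Z a b, D a b s = 0) →
    T.rhs₂.eval D p q = S.rhs₂.eval D p q
  gradAcc : ∀ (D : Valuation d nf ng ns) p q, (∀ a b, ∀ s ∈ Z a b, D a b s = 0) →
    T.gradAcc.eval D p q = S.gradAcc.eval D p q
  gradVel : ∀ (D : Valuation d nf ng ns) p q, (∀ a b, ∀ s ∈ Z a b, D a b s = 0) →
    T.gradVel.eval D p q = S.gradVel.eval D p q
  gradPos : ∀ (D : Valuation d nf ng ns) p q, (∀ a b, ∀ s ∈ Z a b, D a b s = 0) →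
    T.gradPos.eval D p q = S.gradPos.eval D p q

/-- Multiplications for the terminal conditions. -/
def terminalCount (S : Scheme) : ℕ := S.terminal₁.mulCount + S.terminal₂.mulCount

/-- Multiplications for one evaluation of the adjoint's time derivative. -/
def stepCount (S : Scheme) : ℕ := S.rhs₁.mulCount + S.rhs₂.mulCount

/-- Multiplications of a full backward pass in which the solver evaluates the time derivative of
the adjoint and the integrand of `dL/dθ_f` at `n` times. -/
def totalCount (S : Scheme) (n : ℕ) : ℕ :=
  S.terminalCount + n * (S.stepCount + S.gradAcc.mulCount)
    + S.gradVel.mulCount + S.gradPos.mulCount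

/-- At every stage, and in every full backward pass, `S` uses at most as many matrix
multiplications as `T`. -/
structure AtMost (S T : Scheme) : Prop where
  terminal : S.terminalCount ≤ T.terminalCount
  step : S.stepCount ≤ T.stepCount
  gradAcc : S.gradAcc.mulCount ≤ T.gradAcc.mulCount
  gradVel : S.gradVel.mulCount ≤ T.gradVel.mulCount
  gradPos : S.gradPos.mulCount ≤ T.gradPos.mulCount
  total : ∀ n : ℕ, S.totalCount n ≤ T.totalCount n

end Scheme

/-- The derivatives of a second order model at time `t` of a trajectory `(x, v)` on `[t₀, tₙ]`.
The derivatives of the loss are taken at `tₙ`, those of the initial conditions at `t₀`. -/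
def SecondOrderModel.valuation {𝒳 : Type*} {d nf ng ns : ℕ} (M : SecondOrderModel 𝒳 d nf ng ns)
    (X₀ : 𝒳) (θf : Fin nf → ℝ) (θg : Fin ng → ℝ) (θs : Fin ns → ℝ) (t₀ tₙ : ℝ)
    (x v : ℝ → Fin d → ℝ) (t : ℝ) : Valuation d nf ng ns
  | _, _, .lossPos => Matrix.of fun _ j => M.lossPos (x tₙ) (v tₙ) j
  | _, _, .lossVel => Matrix.of fun _ j => M.lossVel (x tₙ) (v tₙ) j
  | _, _, .accPos => M.accPos θf (x t) (v t) t
  | _, _, .accVel => M.accVel θf (x t) (v t) t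
  | _, _, .accVelDot => M.accVelDot θf t₀ tₙ x v t
  | _, _, .accPar => M.accPar θf (x t) (v t) t
  | _, _, .velPos => M.velPos θg (x t₀)
  | _, _, .velPar => M.velPar θg (x t₀)
  | _, _, .posPar => M.posPar X₀ θs

end

end SONODE

/-!
The Jacobian of the coupled field `F = [v, f]` has the blocks `0`, `1`, `∂f/∂x`, `∂f/∂v`, so that
the first order adjoint equation reads `ṙ^A = -(r^B)ᵀ ∂f/∂x`, `ṙ^B = -r^A - (r^B)ᵀ ∂f/∂v`
(`SecondOrderModel.coupled_isAdjoint_iff`). Differentiating the second equation and substituting the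
first gives the second order adjoint equation for `r^B`, and the substitution
`r^A = -ρ̇ - ρᵀ ∂f/∂v` undoes this (`isAdjoint_of_coupled`, `coupled_isAdjoint_concat`). The first
order adjoint equation is linear with continuous coefficients, because `f` is `C¹` and the
trajectory is continuous; its solution with given terminal value is therefore unique
(`eqOn_of_linear_ode`). So a first order adjoint `r` and a second order adjoint `ρ` always satisfy
`r = [-ρ̇ - ρᵀ ∂f/∂v, ρ]`, and the equality of the gradients follows from the block forms of
`∂F/∂θ_f` and `dS/d[θ_s, θ_g]`.

For the lower bounds on the number of products, all matrices are taken to be supported in their top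
left corner, where they multiply like scalars (`MatExpr.eval_smul_corner`). An expression with
`k` products is then a polynomial of degree at most `k + 1` in its variables. This bounds the number
of products of every quantity of the second order method from below by that of the first order
method, except for the right-hand side `ρᵀ ∂f/∂x - ρ̇ᵀ ∂f/∂v - ρᵀ d/dt(∂f/∂v)`, which has degree two
but needs two products if neither `∂f/∂x` nor `∂f/∂v` is known to vanish: an expression with one
product is a linear form plus a product of two linear forms, and the quadratic form `pP - qV` has
rank four (`MatExpr.not_linear_add_mul`). If some dimension in a product is zero, or a factor is
known to vanish, the first order method does without that product. The numbers of products are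
compared stage by stage, which suffices because a scheme may choose its expressions for the stages
independently.
-/

namespace SONODE

noncomputable section

/-! ### Jacobian matrices -/

section Jacobians

variable {α β ι κ : Type*} {H : Type*} [NormedAddCommGroup H] [NormedSpace ℝ H]

theorem jac_apply [Fintype ι] [Fintype κ] [DecidableEq κ] {F : (κ → ℝ) → (ι → ℝ)}
    {y : κ → ℝ} (hF : DifferentiableAt ℝ F y) (i : ι) (j : κ) :
    jac F y i j = fderiv ℝ (fun y => F y i) y (Pi.single j 1) := by
  have := (hasFDerivAt_pi'.mp hF.hasFDerivAt i).fderiv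
  simp only [jac, Matrix.of_apply]
  rw [this]
  rfl

/-- The restriction of a vector to a part of its coordinates, as a continuous linear map. -/
def restrict (f : α → β) : (β → ℝ) →L[ℝ] (α → ℝ) :=
  ContinuousLinearMap.pi fun a => ContinuousLinearMap.proj (f a)

theorem restrict_apply (f : α → β) (z : β → ℝ) : restrict f z = z ∘ f := rfl

theorem single_inl_comp_inl [DecidableEq α] [DecidableEq β] (j : α) :
    (Pi.single (Sum.inl j) 1 : α ⊕ β → ℝ) ∘ Sum.inl = Pi.single j 1 := by
  ext i; simp [Pi.single_apply]

theorem single_inl_comp_inr [DecidableEq α] [DecidableEq β] (j : α) :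
    (Pi.single (Sum.inl j) 1 : α ⊕ β → ℝ) ∘ Sum.inr = 0 := by
  ext i; simp

theorem single_inr_comp_inl [DecidableEq α] [DecidableEq β] (j : β) :
    (Pi.single (Sum.inr j) 1 : α ⊕ β → ℝ) ∘ Sum.inl = 0 := by
  ext i; simp

theorem single_inr_comp_inr [DecidableEq α] [DecidableEq β] (j : β) :
    (Pi.single (Sum.inr j) 1 : α ⊕ β → ℝ) ∘ Sum.inr = Pi.single j 1 := by
  ext i; simp [Pi.single_apply]

/-- The derivative of a function of the two blocks of a vector indexed by a sum type. -/
theorem hasFDerivAt_comp_blocks [Fintype α] [Fintype β] {G : (α → ℝ) → (β → ℝ) → H} {z : α ⊕ β → ℝ}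
    (hG : DifferentiableAt ℝ (fun y : (α → ℝ) × (β → ℝ) => G y.1 y.2)
      (z ∘ Sum.inl, z ∘ Sum.inr)) :
    HasFDerivAt (fun z : α ⊕ β → ℝ => G (z ∘ Sum.inl) (z ∘ Sum.inr))
      ((fderiv ℝ (fun y : (α → ℝ) × (β → ℝ) => G y.1 y.2) (z ∘ Sum.inl, z ∘ Sum.inr)).comp
        ((restrict Sum.inl).prod (restrict Sum.inr))) z :=
  HasFDerivAt.comp (f := fun z : α ⊕ β → ℝ => (z ∘ Sum.inl, z ∘ Sum.inr)) z hG.hasFDerivAt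
    ((restrict (Sum.inl : α → α ⊕ β)).prod (restrict Sum.inr)).hasFDerivAt

theorem fderiv_comp_blocks_single_inl [Fintype α] [Fintype β] [DecidableEq α]
    [DecidableEq β] {G : (α → ℝ) → (β → ℝ) → H} {z : α ⊕ β → ℝ}
    (hG : DifferentiableAt ℝ (fun y : (α → ℝ) × (β → ℝ) => G y.1 y.2)
      (z ∘ Sum.inl, z ∘ Sum.inr)) (j : α) :
    fderiv ℝ (fun z : α ⊕ β → ℝ => G (z ∘ Sum.inl) (z ∘ Sum.inr)) z (Pi.single (Sum.inl j) 1) =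
      fderiv ℝ (fun y => G y (z ∘ Sum.inr)) (z ∘ Sum.inl) (Pi.single j 1) := by
  have h := HasFDerivAt.comp (f := fun y : α → ℝ => (y, z ∘ (Sum.inr : β → α ⊕ β))) (z ∘ Sum.inl)
    hG.hasFDerivAt (hasFDerivAt_prodMk_left _ _)
  rw [(hasFDerivAt_comp_blocks hG).fderiv, (show fderiv ℝ (fun y => G y (z ∘ Sum.inr)) _ = _ from
    h.fderiv)]
  simp [restrict_apply, single_inl_comp_inl, single_inl_comp_inr]

theorem fderiv_comp_blocks_single_inr [Fintype α] [Fintype β] [DecidableEq α]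
    [DecidableEq β] {G : (α → ℝ) → (β → ℝ) → H} {z : α ⊕ β → ℝ}
    (hG : DifferentiableAt ℝ (fun y : (α → ℝ) × (β → ℝ) => G y.1 y.2)
      (z ∘ Sum.inl, z ∘ Sum.inr)) (j : β) :
    fderiv ℝ (fun z : α ⊕ β → ℝ => G (z ∘ Sum.inl) (z ∘ Sum.inr)) z (Pi.single (Sum.inr j) 1) =
      fderiv ℝ (fun y => G (z ∘ Sum.inl) y) (z ∘ Sum.inr) (Pi.single j 1) := by
  have h := HasFDerivAt.comp (f := fun y : β → ℝ => (z ∘ (Sum.inl : α → α ⊕ β), y)) (z ∘ Sum.inr)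
    hG.hasFDerivAt (hasFDerivAt_prodMk_right _ _)
  rw [(hasFDerivAt_comp_blocks hG).fderiv, (show fderiv ℝ (fun y => G (z ∘ Sum.inl) y) _ = _ from
    h.fderiv)]
  simp [restrict_apply, single_inr_comp_inl, single_inr_comp_inr]

theorem jac_comp_blocks_inl [Fintype α] [Fintype β] [Fintype ι] [DecidableEq α]
    [DecidableEq β] {G : (α → ℝ) → (β → ℝ) → (ι → ℝ)} {z : α ⊕ β → ℝ}
    (hG : DifferentiableAt ℝ (fun y : (α → ℝ) × (β → ℝ) => G y.1 y.2)
      (z ∘ Sum.inl, z ∘ Sum.inr)) (i : ι) (j : α) :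
    jac (fun z : α ⊕ β → ℝ => G (z ∘ Sum.inl) (z ∘ Sum.inr)) z i (Sum.inl j) =
      jac (fun y => G y (z ∘ Sum.inr)) (z ∘ Sum.inl) i j :=
  congrFun (fderiv_comp_blocks_single_inl hG j) i

theorem jac_comp_blocks_inr [Fintype α] [Fintype β] [Fintype ι] [DecidableEq α]
    [DecidableEq β] {G : (α → ℝ) → (β → ℝ) → (ι → ℝ)} {z : α ⊕ β → ℝ}
    (hG : DifferentiableAt ℝ (fun y : (α → ℝ) × (β → ℝ) => G y.1 y.2)
      (z ∘ Sum.inl, z ∘ Sum.inr)) (i : ι) (j : β) :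
    jac (fun z : α ⊕ β → ℝ => G (z ∘ Sum.inl) (z ∘ Sum.inr)) z i (Sum.inr j) =
      jac (fun y => G (z ∘ Sum.inl) y) (z ∘ Sum.inr) i j :=
  congrFun (fderiv_comp_blocks_single_inr hG j) i

theorem differentiableAt_sumElim [Fintype α] [Fintype β] [Fintype κ]
    {F : (κ → ℝ) → (α → ℝ)} {G : (κ → ℝ) → (β → ℝ)} {y : κ → ℝ}
    (hF : DifferentiableAt ℝ F y) (hG : DifferentiableAt ℝ G y) :
    DifferentiableAt ℝ (fun y => Sum.elim (F y) (G y) : (κ → ℝ) → α ⊕ β → ℝ) y := by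
  refine differentiableAt_pi.mpr ?_
  rintro (i | i)
  · exact differentiableAt_pi.mp hF i
  · exact differentiableAt_pi.mp hG i

theorem jac_sumElim_inl [Fintype α] [Fintype β] [Fintype κ] [DecidableEq κ]
    {F : (κ → ℝ) → (α → ℝ)} {G : (κ → ℝ) → (β → ℝ)} {y : κ → ℝ}
    (hF : DifferentiableAt ℝ F y) (hG : DifferentiableAt ℝ G y) (i : α) (j : κ) :
    jac (fun y => (Sum.elim (F y) (G y) : α ⊕ β → ℝ)) y (Sum.inl i) j = jac F y i j := by
  rw [jac_apply (differentiableAt_sumElim hF hG), jac_apply hF]; rfl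

theorem jac_sumElim_inr [Fintype α] [Fintype β] [Fintype κ] [DecidableEq κ]
    {F : (κ → ℝ) → (α → ℝ)} {G : (κ → ℝ) → (β → ℝ)} {y : κ → ℝ}
    (hF : DifferentiableAt ℝ F y) (hG : DifferentiableAt ℝ G y) (i : β) (j : κ) :
    jac (fun y => (Sum.elim (F y) (G y) : α ⊕ β → ℝ)) y (Sum.inr i) j = jac G y i j := by
  rw [jac_apply (differentiableAt_sumElim hF hG), jac_apply hG]; rfl

theorem jac_id [Fintype κ] [DecidableEq κ] (y : κ → ℝ) : jac (fun y => y) y = 1 := by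
  ext i j
  simp [jac, Matrix.one_apply, Pi.single_apply]

theorem jac_const [Fintype ι] [Fintype κ] [DecidableEq κ] (c : ι → ℝ) (y : κ → ℝ) :
    jac (fun _ => c) y = 0 := by
  ext i j
  simp [jac]

/-- The chain rule for Jacobian matrices. -/
theorem jac_comp [Fintype ι] [Fintype κ] [DecidableEq κ] [Fintype α]
    [DecidableEq α] {F : (κ → ℝ) → (ι → ℝ)} {G : (α → ℝ) → (κ → ℝ)} {y : α → ℝ}
    (hF : DifferentiableAt ℝ F (G y)) (hG : DifferentiableAt ℝ G y) :
    jac (fun y => F (G y)) y = jac F (G y) * jac G y := by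
  ext i j
  have h : fderiv ℝ (fun y => F (G y)) y = (fderiv ℝ F (G y)).comp (fderiv ℝ G y) :=
    fderiv_comp y hF hG
  have hu : fderiv ℝ G y (Pi.single j 1) = ∑ k, jac G y k j • (Pi.single k 1 : κ → ℝ) := by
    ext k
    simp [jac, Finset.sum_apply, Pi.single_apply]
  simp only [jac, Matrix.of_apply, h, ContinuousLinearMap.comp_apply, Matrix.mul_apply] at hu ⊢
  conv_lhs => rw [hu]
  simp [Finset.sum_apply, mul_comm]

theorem jac_comp_apply {E : Type*} [NormedAddCommGroup E] [NormedSpace ℝ E] [Fintype ι]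
    [Fintype κ] [DecidableEq κ] {G : E → ι → ℝ} {φ : (κ → ℝ) → E} {φ' : (κ → ℝ) →L[ℝ] E}
    {y : κ → ℝ} (hG : DifferentiableAt ℝ G (φ y)) (hφ : HasFDerivAt φ φ' y) (i : ι) (j : κ) :
    jac (fun y => G (φ y)) y i j = fderiv ℝ G (φ y) (φ' (Pi.single j 1)) i := by
  have h : fderiv ℝ (fun y => G (φ y)) y = (fderiv ℝ G (φ y)).comp φ' :=
    (hG.hasFDerivAt.comp y hφ).fderiv
  simp [jac, h]

/-- A Jacobian matrix of a `C¹` function in some of its variables is continuous along a curve. -/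
theorem continuousOn_jac_comp {E : Type*} [NormedAddCommGroup E] [NormedSpace ℝ E]
    [Fintype ι] [Fintype κ] [DecidableEq κ] {G : E → ι → ℝ} (hG : ContDiff ℝ 1 G)
    {φ : ℝ → (κ → ℝ) → E} {φ' : (κ → ℝ) →L[ℝ] E} {y : ℝ → κ → ℝ}
    (hφ : ∀ t, HasFDerivAt (φ t) φ' (y t)) {s : Set ℝ}
    (hc : ContinuousOn (fun t => φ t (y t)) s) (i : ι) (j : κ) :
    ContinuousOn (fun t => jac (fun y => G (φ t y)) (y t) i j) s := by
  simp_rw [fun t => jac_comp_apply (hG.differentiable one_ne_zero _) (hφ t) i j]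
  have h := ((hG.continuous_fderiv one_ne_zero).comp_continuousOn hc).clm_apply
    (continuousOn_const (c := φ' (Pi.single j 1)))
  exact (continuous_apply i).comp_continuousOn h

end Jacobians

/-! ### Linear differential equations -/

section LinearODE

/-- Uniqueness, backwards in time, for `ṙ = -r A(t)` with a continuous matrix `A`. -/
theorem eqOn_of_linear_ode {ι : Type*} [Fintype ι] {A : ℝ → Matrix ι ι ℝ} {a b : ℝ}
    (hA : ∀ i j, ContinuousOn (fun t => A t i j) (Set.Icc a b)) {r s : ℝ → ι → ℝ}
    (hr : ∀ t ∈ Set.Icc a b, HasDerivWithinAt r (-(r t ᵥ* A t)) (Set.Icc a b) t)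
    (hs : ∀ t ∈ Set.Icc a b, HasDerivWithinAt s (-(s t ᵥ* A t)) (Set.Icc a b) t)
    (h : r b = s b) : Set.EqOn r s (Set.Icc a b) := by
  obtain ⟨C, hC⟩ := isCompact_Icc.exists_bound_of_continuousOn
    (f := fun t => ∑ j, ∑ i, |A t i j|)
    (continuousOn_finsetSum _ fun j _ => continuousOn_finsetSum _ fun i _ => (hA i j).abs)
  have hleft : ∀ {r : ℝ → ι → ℝ},
      (∀ t ∈ Set.Icc a b, HasDerivWithinAt r (-(r t ᵥ* A t)) (Set.Icc a b) t) →
      ∀ t ∈ Set.Ioc a b, HasDerivWithinAt r (-(r t ᵥ* A t)) (Set.Iic t) t := fun hr t ht =>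
    (hr t ⟨ht.1.le, ht.2⟩).mono_of_mem_nhdsWithin (by
      filter_upwards [self_mem_nhdsWithin, mem_nhdsWithin_of_mem_nhds (Ioi_mem_nhds ht.1)]
        with u hu hu' using ⟨hu'.le, le_trans hu ht.2⟩)
  refine ODE_solution_unique_of_mem_Icc_left (K := C.toNNReal) (s := fun _ => Set.univ)
    (v := fun t r => -(r ᵥ* A t)) (fun t ht => ?_) (fun t ht => (hr t ht).continuousWithinAt)
    (hleft hr) (fun _ _ => trivial) (fun t ht => (hs t ht).continuousWithinAt) (hleft hs)
    (fun _ _ => trivial) h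
  refine LipschitzOnWith.of_dist_le_mul fun x _ y _ => ?_
  have hCt := (le_abs_self _).trans (hC t ⟨ht.1.le, ht.2⟩)
  have hC0 : 0 ≤ C := le_trans (by positivity) hCt
  rw [dist_neg_neg, dist_eq_norm, ← Matrix.sub_vecMul, dist_eq_norm, Real.coe_toNNReal _ hC0,
    pi_norm_le_iff_of_nonneg (by positivity)]
  intro j
  calc ‖((x - y) ᵥ* A t) j‖ ≤ ∑ i, ‖(x - y) i * A t i j‖ := norm_sum_le _ _
    _ ≤ ∑ i, ‖x - y‖ * |A t i j| := by
      gcongr with i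
      rw [norm_mul]
      exact mul_le_mul_of_nonneg_right (norm_le_pi_norm _ i) (norm_nonneg _)
    _ = (∑ i, |A t i j|) * ‖x - y‖ := by rw [← Finset.mul_sum, mul_comm]
    _ ≤ C * ‖x - y‖ := by
      gcongr
      exact (Finset.single_le_sum (f := fun j => ∑ i, |A t i j|)
        (fun _ _ => by positivity) (Finset.mem_univ j)).trans hCt

theorem hasDerivWithinAt_vecMul {ι κ : Type*} [Fintype ι] [Fintype κ] {r : ℝ → ι → ℝ}
    {r' : ι → ℝ} {A : ℝ → Matrix ι κ ℝ} {A' : Matrix ι κ ℝ} {s : Set ℝ} {t : ℝ}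
    (hr : HasDerivWithinAt r r' s t)
    (hA : ∀ i j, HasDerivWithinAt (fun t => A t i j) (A' i j) s t) :
    HasDerivWithinAt (fun t => r t ᵥ* A t) (r' ᵥ* A t + r t ᵥ* A') s t := by
  refine hasDerivWithinAt_pi.mpr fun j => ?_
  have := HasDerivWithinAt.fun_sum (u := Finset.univ) fun i _ =>
    (hasDerivWithinAt_pi.mp hr i).mul (hA i j)
  simpa [Matrix.vecMul, dotProduct, Finset.sum_add_distrib] using this

end LinearODE

/-! ### The adjoint of the coupled system -/

namespace SecondOrderModel

variable {𝒳 : Type*} {d nf ng ns : ℕ} {M : SecondOrderModel 𝒳 d nf ng ns}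
  {X₀ : 𝒳} {θf : Fin nf → ℝ} {θg : Fin ng → ℝ} {θs : Fin ns → ℝ} {t₀ tₙ : ℝ}
  {x v : ℝ → Fin d → ℝ}

/-- `∂F/∂z` in blocks, for `F = [v, f]` and `z = [x, v]`. -/
theorem jac_coupled_field
    (hacc : Differentiable ℝ (fun y : (Fin d → ℝ) × (Fin d → ℝ) × ℝ × (Fin nf → ℝ) =>
      M.acc y.1 y.2.1 y.2.2.1 y.2.2.2)) (z : Fin d ⊕ Fin d → ℝ) (t : ℝ) :
    jac (fun y => M.coupled.field y t θf) z =
      Matrix.fromBlocks 0 1 (M.accPos θf (z ∘ Sum.inl) (z ∘ Sum.inr) t)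
        (M.accVel θf (z ∘ Sum.inl) (z ∘ Sum.inr) t) := by
  have hG : Differentiable ℝ (fun y : (Fin d → ℝ) × (Fin d → ℝ) => M.acc y.1 y.2 t θf) :=
    hacc.comp (f := fun y : (Fin d → ℝ) × (Fin d → ℝ) => (y.1, y.2, t, θf)) (by fun_prop)
  have hv : Differentiable ℝ (fun y : (Fin d → ℝ) × (Fin d → ℝ) => y.2) := differentiable_snd
  have h₁ := (hasFDerivAt_comp_blocks (G := fun _ y => y)
    (hv (z ∘ Sum.inl, z ∘ Sum.inr))).differentiableAt
  have h₂ := (hasFDerivAt_comp_blocks (G := fun x v => M.acc x v t θf)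
    (hG (z ∘ Sum.inl, z ∘ Sum.inr))).differentiableAt
  ext i j
  rcases i with i | i
  · refine (jac_sumElim_inl h₁ h₂ i j).trans ?_
    rcases j with j | j
    · rw [jac_comp_blocks_inl (G := fun _ y => y) (hv _), jac_const]; rfl
    · rw [jac_comp_blocks_inr (G := fun _ y => y) (hv _), jac_id]; rfl
  · refine (jac_sumElim_inr h₁ h₂ i j).trans ?_
    rcases j with j | j
    · exact jac_comp_blocks_inl (G := fun x v => M.acc x v t θf) (hG _) i j
    · exact jac_comp_blocks_inr (G := fun x v => M.acc x v t θf) (hG _) i j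

theorem jac_coupled_field_par
    (hacc : Differentiable ℝ (fun y : (Fin d → ℝ) × (Fin d → ℝ) × ℝ × (Fin nf → ℝ) =>
      M.acc y.1 y.2.1 y.2.2.1 y.2.2.2)) (z : Fin d ⊕ Fin d → ℝ) (t : ℝ) :
    jac (fun θ => M.coupled.field z t θ) θf =
      Matrix.fromRows 0 (M.accPar θf (z ∘ Sum.inl) (z ∘ Sum.inr) t) := by
  have h₂ : Differentiable ℝ (fun θ => M.acc (z ∘ Sum.inl) (z ∘ Sum.inr) t θ) :=
    hacc.comp (f := fun θ => (z ∘ Sum.inl, z ∘ Sum.inr, t, θ)) (by fun_prop)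
  ext i j
  rcases i with i | i
  · exact (jac_sumElim_inl (differentiableAt_const _) (h₂ _) i j).trans (by rw [jac_const]; rfl)
  · exact jac_sumElim_inr (differentiableAt_const _) (h₂ _) i j

/-- `dS/d[θ_s, θ_g]` in blocks, for `S = [s, g(s, θ_g)]`. -/
theorem jac_coupled_init
    (hvel : Differentiable ℝ (fun y : (Fin d → ℝ) × (Fin ng → ℝ) => M.vel y.1 y.2))
    (hpos : Differentiable ℝ (fun θ => M.pos X₀ θ)) :
    jac (fun θ => M.coupled.init X₀ θ) (Sum.elim θs θg) =
      Matrix.fromBlocks (M.posPar X₀ θs) 0 (M.velPos θg (M.pos X₀ θs) * M.posPar X₀ θs)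
        (M.velPar θg (M.pos X₀ θs)) := by
  have hP : Differentiable ℝ (fun y : (Fin ns → ℝ) × (Fin ng → ℝ) => M.pos X₀ y.1) :=
    hpos.comp differentiable_fst
  have hV : Differentiable ℝ
      (fun y : (Fin ns → ℝ) × (Fin ng → ℝ) => M.vel (M.pos X₀ y.1) y.2) :=
    hvel.comp (hP.prodMk differentiable_snd)
  have hvx : Differentiable ℝ (fun y => M.vel y θg) :=
    hvel.comp (f := fun y => (y, θg)) (by fun_prop)
  have h₁ := (hasFDerivAt_comp_blocks (z := Sum.elim θs θg)
    (G := fun y _ => M.pos X₀ y) (hP _)).differentiableAt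
  have h₂ := (hasFDerivAt_comp_blocks (z := Sum.elim θs θg)
    (G := fun y θ => M.vel (M.pos X₀ y) θ) (hV _)).differentiableAt
  ext i j
  rcases i with i | i
  · refine (jac_sumElim_inl h₁ h₂ i j).trans ?_
    rcases j with j | j
    · exact jac_comp_blocks_inl (z := Sum.elim θs θg) (G := fun y _ => M.pos X₀ y) (hP _) i j
    · rw [jac_comp_blocks_inr (z := Sum.elim θs θg) (G := fun y _ => M.pos X₀ y) (hP _), jac_const]
      rfl
  · refine (jac_sumElim_inr h₁ h₂ i j).trans ?_
    rcases j with j | j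
    · rw [jac_comp_blocks_inl (z := Sum.elim θs θg) (G := fun y θ => M.vel (M.pos X₀ y) θ) (hV _)]
      exact congrFun (congrFun (jac_comp (hvx _) (hpos θs)) i) j
    · exact jac_comp_blocks_inr (z := Sum.elim θs θg)
        (G := fun y θ => M.vel (M.pos X₀ y) θ) (hV _) i j

theorem grad_coupled_loss
    (hloss : Differentiable ℝ (fun y : (Fin d → ℝ) × (Fin d → ℝ) => M.loss y.1 y.2))
    (z : Fin d ⊕ Fin d → ℝ) :
    grad M.coupled.loss z = Sum.elim (M.lossPos (z ∘ Sum.inl) (z ∘ Sum.inr))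
      (M.lossVel (z ∘ Sum.inl) (z ∘ Sum.inr)) := by
  ext j
  rcases j with j | j
  · exact fderiv_comp_blocks_single_inl (G := M.loss) (hloss _) j
  · exact fderiv_comp_blocks_single_inr (G := M.loss) (hloss _) j

/-- The first order adjoint of the coupled system, written in its blocks `[r^A, r^B]`. -/
theorem coupled_isAdjoint_iff
    (hacc : Differentiable ℝ (fun y : (Fin d → ℝ) × (Fin d → ℝ) × ℝ × (Fin nf → ℝ) =>
      M.acc y.1 y.2.1 y.2.2.1 y.2.2.2))
    (hloss : Differentiable ℝ (fun y : (Fin d → ℝ) × (Fin d → ℝ) => M.loss y.1 y.2))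
    {r : ℝ → Fin d ⊕ Fin d → ℝ} :
    M.coupled.IsAdjoint θf t₀ tₙ (concat x v) r ↔
      r tₙ ∘ Sum.inl = M.lossPos (x tₙ) (v tₙ) ∧ r tₙ ∘ Sum.inr = M.lossVel (x tₙ) (v tₙ) ∧
      (∀ t ∈ Set.Icc t₀ tₙ, HasDerivWithinAt (fun t => r t ∘ Sum.inl)
        (-((r t ∘ Sum.inr) ᵥ* M.accPos θf (x t) (v t) t)) (Set.Icc t₀ tₙ) t) ∧
      ∀ t ∈ Set.Icc t₀ tₙ, HasDerivWithinAt (fun t => r t ∘ Sum.inr)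
        (-(r t ∘ Sum.inl) - (r t ∘ Sum.inr) ᵥ* M.accVel θf (x t) (v t) t) (Set.Icc t₀ tₙ) t := by
  have hode : ∀ t, -(r t ᵥ* jac (fun y => M.coupled.field y t θf) (concat x v t)) =
      Sum.elim (-((r t ∘ Sum.inr) ᵥ* M.accPos θf (x t) (v t) t))
        (-(r t ∘ Sum.inl) - (r t ∘ Sum.inr) ᵥ* M.accVel θf (x t) (v t) t) := fun t => by
    rw [jac_coupled_field hacc, Matrix.vecMul_fromBlocks]
    ext j
    rcases j with j | j
    · simp [concat]
    · simp [concat]; ring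
  have hterm : grad M.coupled.loss (concat x v tₙ) =
      Sum.elim (M.lossPos (x tₙ) (v tₙ)) (M.lossVel (x tₙ) (v tₙ)) := grad_coupled_loss hloss _
  have hsplit : ∀ (u : Fin d ⊕ Fin d → ℝ) t,
      HasDerivWithinAt r u (Set.Icc t₀ tₙ) t ↔
        HasDerivWithinAt (fun t => r t ∘ Sum.inl) (u ∘ Sum.inl) (Set.Icc t₀ tₙ) t ∧
        HasDerivWithinAt (fun t => r t ∘ Sum.inr) (u ∘ Sum.inr) (Set.Icc t₀ tₙ) t := fun u t => by
    simp only [hasDerivWithinAt_pi, Sum.forall, Function.comp_apply]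
  constructor
  · rintro ⟨h, h'⟩
    rw [hterm] at h
    refine ⟨by rw [h]; rfl, by rw [h]; rfl, fun t ht => ?_, fun t ht => ?_⟩
    · have := h' t ht
      rw [hode, hsplit] at this
      exact this.1
    · have := h' t ht
      rw [hode, hsplit] at this
      exact this.2
  · rintro ⟨h₁, h₂, h₃, h₄⟩
    refine ⟨?_, fun t ht => ?_⟩
    · rw [hterm, ← h₁, ← h₂, Sum.elim_comp_inl_inr]
    · rw [hode, hsplit]
      exact ⟨h₃ t ht, h₄ t ht⟩

theorem coupled_gradFieldIntegrand
    (hacc : Differentiable ℝ (fun y : (Fin d → ℝ) × (Fin d → ℝ) × ℝ × (Fin nf → ℝ) =>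
      M.acc y.1 y.2.1 y.2.2.1 y.2.2.2)) (r : ℝ → Fin d ⊕ Fin d → ℝ) (t : ℝ) :
    M.coupled.gradFieldIntegrand θf (concat x v) r t =
      M.gradAccIntegrand θf x v (fun t => r t ∘ Sum.inr) t := by
  rw [FirstOrderModel.gradFieldIntegrand, jac_coupled_field_par hacc, Matrix.vecMul_fromRows,
    Matrix.vecMul_zero, zero_add]
  rfl

theorem coupled_gradInit
    (hvel : Differentiable ℝ (fun y : (Fin d → ℝ) × (Fin ng → ℝ) => M.vel y.1 y.2))
    (hpos : Differentiable ℝ (fun θ => M.pos X₀ θ)) (r : ℝ → Fin d ⊕ Fin d → ℝ) :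
    M.coupled.gradInit X₀ (Sum.elim θs θg) t₀ r =
      Sum.elim ((r t₀ ∘ Sum.inl + (r t₀ ∘ Sum.inr) ᵥ* M.velPos θg (M.pos X₀ θs))
          ᵥ* M.posPar X₀ θs)
        ((r t₀ ∘ Sum.inr) ᵥ* M.velPar θg (M.pos X₀ θs)) := by
  rw [FirstOrderModel.gradInit, jac_coupled_init hvel hpos, Matrix.vecMul_fromBlocks,
    Matrix.add_vecMul, Matrix.vecMul_vecMul, Matrix.vecMul_zero, zero_add]

namespace IsTrajectory

variable (htraj : M.IsTrajectory X₀ θf θg θs t₀ tₙ x v)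
include htraj

theorem coupled : M.coupled.IsTrajectory X₀ θf (Sum.elim θs θg) t₀ tₙ (concat x v) where
  initial := by
    ext i
    rcases i with i | i
    · exact congrFun htraj.initial_pos i
    · have := congrFun htraj.initial_vel i
      rw [htraj.initial_pos] at this
      exact this
  ode t ht := by
    refine hasDerivWithinAt_pi.mpr ?_
    rintro (i | i)
    · exact hasDerivWithinAt_pi.mp (htraj.velocity t ht) i
    · exact hasDerivWithinAt_pi.mp (htraj.ode t ht) i

theorem continuousOn_pos : ContinuousOn x (Set.Icc t₀ tₙ) :=
  fun t ht => (htraj.velocity t ht).continuousWithinAt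

theorem continuousOn_vel : ContinuousOn v (Set.Icc t₀ tₙ) :=
  fun t ht => (htraj.ode t ht).continuousWithinAt

/-- The chain rule for `∂f/∂v` along the trajectory. -/
theorem hasDerivWithinAt_accVel {i j : Fin d}
    (haccVel : Differentiable ℝ (fun y : (Fin d → ℝ) × (Fin d → ℝ) × ℝ =>
      M.accVel θf y.1 y.2.1 y.2.2 i j)) {t : ℝ} (ht : t ∈ Set.Icc t₀ tₙ) :
    HasDerivWithinAt (fun τ => M.accVel θf (x τ) (v τ) τ i j)
      (fderiv ℝ (fun y : (Fin d → ℝ) × (Fin d → ℝ) × ℝ => M.accVel θf y.1 y.2.1 y.2.2 i j)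
        (x t, v t, t) (v t, M.acc (x t) (v t) t θf, 1)) (Set.Icc t₀ tₙ) t :=
  HasFDerivAt.comp_hasDerivWithinAt (f := fun τ => (x τ, v τ, τ)) t
    (haccVel (x t, v t, t)).hasFDerivAt
    ((htraj.velocity t ht).prodMk ((htraj.ode t ht).prodMk (hasDerivWithinAt_id t _)))

theorem hasDerivWithinAt_accVelDot
    (haccVel : ∀ i j, Differentiable ℝ (fun y : (Fin d → ℝ) × (Fin d → ℝ) × ℝ =>
      M.accVel θf y.1 y.2.1 y.2.2 i j)) {t : ℝ} (ht : t ∈ Set.Icc t₀ tₙ) (i j : Fin d) :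
    HasDerivWithinAt (fun τ => M.accVel θf (x τ) (v τ) τ i j)
      (M.accVelDot θf t₀ tₙ x v t i j) (Set.Icc t₀ tₙ) t :=
  (htraj.hasDerivWithinAt_accVel (haccVel i j) ht).differentiableWithinAt.hasDerivWithinAt

theorem continuousOn_jac_coupled_field
    (hacc : ContDiff ℝ 1 (fun y : (Fin d → ℝ) × (Fin d → ℝ) × ℝ × (Fin nf → ℝ) =>
      M.acc y.1 y.2.1 y.2.2.1 y.2.2.2)) (i j : Fin d ⊕ Fin d) :
    ContinuousOn (fun t => jac (fun y => M.coupled.field y t θf) (concat x v t) i j)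
      (Set.Icc t₀ tₙ) := by
  have hx := htraj.continuousOn_pos
  have hv := htraj.continuousOn_vel
  have hc : ContinuousOn (fun t => (x t, v t, t, θf)) (Set.Icc t₀ tₙ) := by fun_prop
  simp_rw [jac_coupled_field (hacc.differentiable one_ne_zero)]
  rcases i with i | i <;> rcases j with j | j
  · exact continuousOn_const
  · exact continuousOn_const
  · exact continuousOn_jac_comp hacc (φ := fun t y => (y, v t, t, θf)) (y := x)
      (fun t => hasFDerivAt_prodMk_left _ _) hc i j
  · exact continuousOn_jac_comp hacc (φ := fun t y => (x t, y, t, θf)) (y := v)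
      (fun t => (hasFDerivAt_const _ _).prodMk (hasFDerivAt_prodMk_left _ _)) hc i j

theorem continuousOn_accPar
    (hacc : ContDiff ℝ 1 (fun y : (Fin d → ℝ) × (Fin d → ℝ) × ℝ × (Fin nf → ℝ) =>
      M.acc y.1 y.2.1 y.2.2.1 y.2.2.2)) (i : Fin d) (j : Fin nf) :
    ContinuousOn (fun t => M.accPar θf (x t) (v t) t i j) (Set.Icc t₀ tₙ) := by
  have hx := htraj.continuousOn_pos
  have hv := htraj.continuousOn_vel
  have hc : ContinuousOn (fun t => (x t, v t, t, θf)) (Set.Icc t₀ tₙ) := by fun_prop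
  exact continuousOn_jac_comp hacc (φ := fun t y => (x t, v t, t, y)) (y := fun _ => θf)
    (fun t => (hasFDerivAt_const _ _).prodMk ((hasFDerivAt_const _ _).prodMk
      ((hasFDerivAt_const _ _).prodMk (hasFDerivAt_id _)))) hc i j

theorem intervalIntegrable_gradAccIntegrand (h : t₀ < tₙ)
    (hacc : ContDiff ℝ 1 (fun y : (Fin d → ℝ) × (Fin d → ℝ) × ℝ × (Fin nf → ℝ) =>
      M.acc y.1 y.2.1 y.2.2.1 y.2.2.2)) {ρ : ℝ → Fin d → ℝ}
    (hρ : ContinuousOn ρ (Set.Icc t₀ tₙ)) :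
    IntervalIntegrable (M.gradAccIntegrand θf x v ρ) MeasureTheory.volume tₙ t₀ := by
  apply ContinuousOn.intervalIntegrable
  rw [Set.uIcc_of_ge h.le]
  refine continuousOn_pi.mpr fun j => ?_
  exact continuousOn_finsetSum Finset.univ fun i _ =>
    (continuousOn_pi.mp hρ i).mul (htraj.continuousOn_accPar hacc i j)

/-- The block `r^B` of a first order adjoint: differentiating `ṙ^B = -r^A - (r^B)ᵀ ∂f/∂v` by the
product rule and eliminating `ṙ^A` gives the second order adjoint equation. -/
theorem isAdjoint_of_coupled
    (hacc : ContDiff ℝ 1 (fun y : (Fin d → ℝ) × (Fin d → ℝ) × ℝ × (Fin nf → ℝ) =>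
      M.acc y.1 y.2.1 y.2.2.1 y.2.2.2))
    (haccVel : ∀ i j, Differentiable ℝ (fun y : (Fin d → ℝ) × (Fin d → ℝ) × ℝ =>
      M.accVel θf y.1 y.2.1 y.2.2 i j))
    (hloss : Differentiable ℝ (fun y : (Fin d → ℝ) × (Fin d → ℝ) => M.loss y.1 y.2))
    {r : ℝ → Fin d ⊕ Fin d → ℝ} (hr : M.coupled.IsAdjoint θf t₀ tₙ (concat x v) r) :
    M.IsAdjoint θf t₀ tₙ x v (fun t => r t ∘ Sum.inr)
      (fun t => -(r t ∘ Sum.inl) - (r t ∘ Sum.inr) ᵥ* M.accVel θf (x t) (v t) t) := by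
  obtain ⟨h₁, h₂, h₃, h₄⟩ :=
    (coupled_isAdjoint_iff (hacc.differentiable one_ne_zero) hloss).mp hr
  refine ⟨h₂, by simp only [h₁, h₂], h₄, fun t ht => ?_⟩
  refine ((h₃ t ht).neg.sub (hasDerivWithinAt_vecMul (h₄ t ht)
    (htraj.hasDerivWithinAt_accVelDot haccVel ht))).congr_deriv ?_
  rw [neg_neg, sub_sub]

/-- Conversely, `r^A = -ρ̇ - ρᵀ ∂f/∂v` and `r^B = ρ` form a first order adjoint. -/
theorem coupled_isAdjoint_concat
    (hacc : ContDiff ℝ 1 (fun y : (Fin d → ℝ) × (Fin d → ℝ) × ℝ × (Fin nf → ℝ) =>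
      M.acc y.1 y.2.1 y.2.2.1 y.2.2.2))
    (haccVel : ∀ i j, Differentiable ℝ (fun y : (Fin d → ℝ) × (Fin d → ℝ) × ℝ =>
      M.accVel θf y.1 y.2.1 y.2.2 i j))
    (hloss : Differentiable ℝ (fun y : (Fin d → ℝ) × (Fin d → ℝ) => M.loss y.1 y.2))
    {r w : ℝ → Fin d → ℝ} (hr : M.IsAdjoint θf t₀ tₙ x v r w) :
    M.coupled.IsAdjoint θf t₀ tₙ (concat x v)
      (concat (fun t => -w t - r t ᵥ* M.accVel θf (x t) (v t) t) r) := by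
  refine (coupled_isAdjoint_iff (hacc.differentiable one_ne_zero) hloss).mpr
    ⟨?_, hr.terminal, fun t ht => ?_, fun t ht => ?_⟩
  · simp only [concat, Sum.elim_comp_inl, hr.terminal, hr.terminal_deriv]
    abel
  · simp only [concat, Sum.elim_comp_inl, Sum.elim_comp_inr]
    refine ((hr.ode t ht).neg.sub (hasDerivWithinAt_vecMul (hr.deriv t ht)
      (htraj.hasDerivWithinAt_accVelDot haccVel ht))).congr_deriv ?_
    abel
  · simp only [concat, Sum.elim_comp_inl, Sum.elim_comp_inr]
    refine (hr.deriv t ht).congr_deriv ?_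
    abel

/-- A first order adjoint is `[-ρ̇ - ρᵀ ∂f/∂v, ρ]` for every second order adjoint `ρ`, because the
latter is a first order adjoint and these are unique. -/
theorem eqOn_concat_of_isAdjoint
    (hacc : ContDiff ℝ 1 (fun y : (Fin d → ℝ) × (Fin d → ℝ) × ℝ × (Fin nf → ℝ) =>
      M.acc y.1 y.2.1 y.2.2.1 y.2.2.2))
    (haccVel : ∀ i j, Differentiable ℝ (fun y : (Fin d → ℝ) × (Fin d → ℝ) × ℝ =>
      M.accVel θf y.1 y.2.1 y.2.2 i j))
    (hloss : Differentiable ℝ (fun y : (Fin d → ℝ) × (Fin d → ℝ) => M.loss y.1 y.2))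
    {r : ℝ → Fin d ⊕ Fin d → ℝ} {ρ w : ℝ → Fin d → ℝ}
    (hr : M.coupled.IsAdjoint θf t₀ tₙ (concat x v) r) (hρ : M.IsAdjoint θf t₀ tₙ x v ρ w) :
    Set.EqOn r (concat (fun t => -w t - ρ t ᵥ* M.accVel θf (x t) (v t) t) ρ)
      (Set.Icc t₀ tₙ) :=
  have hρ' := htraj.coupled_isAdjoint_concat hacc haccVel hloss hρ
  eqOn_of_linear_ode (htraj.continuousOn_jac_coupled_field hacc) hr.ode hρ'.ode
    (hr.terminal.trans hρ'.terminal.symm)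

end IsTrajectory

/-- The first order scheme computes the first order adjoint: after the splitting into blocks the two
sides agree by definition. -/
theorem coupled_isAdjoint_iff_isRun
    (hacc : Differentiable ℝ (fun y : (Fin d → ℝ) × (Fin d → ℝ) × ℝ × (Fin nf → ℝ) =>
      M.acc y.1 y.2.1 y.2.2.1 y.2.2.2))
    (hloss : Differentiable ℝ (fun y : (Fin d → ℝ) × (Fin d → ℝ) => M.loss y.1 y.2))
    {r : ℝ → Fin d ⊕ Fin d → ℝ} :
    M.coupled.IsAdjoint θf t₀ tₙ (concat x v) r ↔
      Scheme.firstOrder.IsRun (M.valuation X₀ θf θg θs t₀ tₙ x v) t₀ tₙ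
        (fun t => r t ∘ Sum.inl) (fun t => r t ∘ Sum.inr) :=
  (coupled_isAdjoint_iff hacc hloss).trans
    ⟨fun ⟨h₁, h₂, h₃, h₄⟩ => ⟨h₁, h₂, h₃, h₄⟩, fun ⟨h₁, h₂, h₃, h₄⟩ => ⟨h₁, h₂, h₃, h₄⟩⟩

theorem isAdjoint_iff_isRun {ρ w : ℝ → Fin d → ℝ} :
    M.IsAdjoint θf t₀ tₙ x v ρ w ↔
      Scheme.secondOrder.IsRun (M.valuation X₀ θf θg θs t₀ tₙ x v) t₀ tₙ ρ w :=
  ⟨fun ⟨h₁, h₂, h₃, h₄⟩ => ⟨h₁, h₂, h₃, h₄⟩, fun ⟨h₁, h₂, h₃, h₄⟩ => ⟨h₁, h₂, h₃, h₄⟩⟩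

end SecondOrderModel

/-! ### Scalar values of matrix expressions -/

namespace MatExpr

/-- Every expression evaluated at `1 × 1` matrices: the derivatives have the values `δ`, the two
halves of the state the values `p` and `q`. -/
def scalarEval (δ : (a b : Shape) → Datum a b → ℝ) (p q : ℝ) :
    {a b : Shape} → MatExpr a b → ℝ
  | _, _, fst => p
  | _, _, snd => q
  | _, _, datum s => δ _ _ s
  | _, _, zero => 0
  | _, _, add e₁ e₂ => scalarEval δ p q e₁ + scalarEval δ p q e₂
  | _, _, sub e₁ e₂ => scalarEval δ p q e₁ - scalarEval δ p q e₂
  | _, _, neg e => -scalarEval δ p q e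
  | _, _, smul c e => c * scalarEval δ p q e
  | _, _, mul e₁ e₂ => scalarEval δ p q e₁ * scalarEval δ p q e₂

/-- The matrix unit with entry `1` in the top left corner; it is zero if a side is zero. -/
def corner (m n : ℕ) : Matrix (Fin m) (Fin n) ℝ :=
  Matrix.of fun i j => if i.val = 0 ∧ j.val = 0 then 1 else 0

theorem corner_mul_corner {m n k : ℕ} (hn : 0 < n) :
    corner m n * corner n k = corner m k := by
  ext i j
  rw [Matrix.mul_apply, Finset.sum_eq_single ⟨0, hn⟩]
  · by_cases hi : i.val = 0 <;> by_cases hj : j.val = 0 <;> simp [corner, hi, hj]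
  · intro b _ hb
    have : b.val ≠ 0 := fun h => hb (Fin.ext h)
    simp [corner, this]
  · simp

/-- No derivative has the parameter dimensions as its number of rows. -/
theorem scalarEval_eq_zero_of_row_shape (δ : (a b : Shape) → Datum a b → ℝ) (p q : ℝ)
    {a b : Shape} (e : MatExpr a b) (hu : a ≠ .unit) (hs : a ≠ .state) :
    scalarEval δ p q e = 0 := by
  induction e with
  | fst => exact absurd rfl hu
  | snd => exact absurd rfl hu
  | datum s => cases s <;> simp_all
  | zero => rfl
  | add e₁ e₂ h₁ h₂ => simp [scalarEval, h₁ hu hs, h₂ hu hs]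
  | sub e₁ e₂ h₁ h₂ => simp [scalarEval, h₁ hu hs, h₂ hu hs]
  | neg e h => simp [scalarEval, h hu hs]
  | smul c e h => simp [scalarEval, h hu hs]
  | mul e₁ e₂ h₁ h₂ => simp [scalarEval, h₁ hu hs]

/-- Matrices supported in the top left corner multiply like scalars. -/
theorem eval_smul_corner {d nf ng ns : ℕ} (hd : 0 < d) (δ : (a b : Shape) → Datum a b → ℝ)
    (p q : ℝ) {a b : Shape} (e : MatExpr a b) :
    eval (d := d) (nf := nf) (ng := ng) (ns := ns) (fun a b s => δ a b s • corner _ _)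
      (fun j => if j.val = 0 then p else 0) (fun j => if j.val = 0 then q else 0) e
      = scalarEval δ p q e • corner _ _ := by
  induction e with
  | fst =>
    ext i j
    have : i.val = 0 := Nat.lt_one_iff.mp i.isLt
    simp [eval, scalarEval, corner, this]
  | snd =>
    ext i j
    have : i.val = 0 := Nat.lt_one_iff.mp i.isLt
    simp [eval, scalarEval, corner, this]
  | datum s => rfl
  | zero => simp [eval, scalarEval]
  | add e₁ e₂ h₁ h₂ => simp only [eval, scalarEval, h₁, h₂, add_smul]
  | sub e₁ e₂ h₁ h₂ => simp only [eval, scalarEval, h₁, h₂, sub_smul]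
  | neg e h => simp only [eval, scalarEval, h, neg_smul]
  | smul c e h => simp only [eval, scalarEval, h, mul_smul]
  | @mul a b c e₁ e₂ h₁ h₂ =>
    simp only [eval, scalarEval, h₁, h₂]
    by_cases hb : 0 < b.size d nf ng ns
    · rw [Matrix.smul_mul, Matrix.mul_smul, smul_smul, corner_mul_corner hb]
    -- A product over an empty dimension is zero. Here `b` is a parameter dimension, so that the
    -- scalar value of `e₂` is zero as well.
    · have h0 : scalarEval δ p q e₂ = 0 := by
        apply scalarEval_eq_zero_of_row_shape
        · rintro rfl; exact hb Nat.one_pos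
        · rintro rfl; exact hb hd
      simp [h0]

/-- An expression with `k` products is a polynomial of degree at most `k + 1` in a common factor
of all its variables. -/
theorem exists_polynomial_scalarEval (δ : (a b : Shape) → Datum a b → ℝ) (p q : ℝ)
    {a b : Shape} (e : MatExpr a b) :
    ∃ P : Polynomial ℝ, P.natDegree ≤ e.mulCount + 1 ∧
      ∀ c : ℝ, scalarEval (fun a b s => c * δ a b s) (c * p) (c * q) e = P.eval c := by
  have hlin : ∀ y : ℝ, ∃ P : Polynomial ℝ, P.natDegree ≤ 0 + 1 ∧ ∀ c : ℝ, c * y = P.eval c :=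
    fun y => ⟨Polynomial.X * Polynomial.C y,
      (Polynomial.natDegree_mul_C_le _ y).trans Polynomial.natDegree_X_le, fun c => by simp; ring⟩
  induction e with
  | fst => exact hlin p
  | snd => exact hlin q
  | datum s => exact hlin _
  | zero => exact ⟨0, by simp, fun c => by simp [scalarEval]⟩
  | add e₁ e₂ h₁ h₂ =>
    obtain ⟨P, hP, hP'⟩ := h₁
    obtain ⟨Q, hQ, hQ'⟩ := h₂
    refine ⟨P + Q, (Polynomial.natDegree_add_le _ _).trans ?_,
      fun c => by simp [scalarEval, hP', hQ']⟩
    simp only [mulCount]; omega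
  | sub e₁ e₂ h₁ h₂ =>
    obtain ⟨P, hP, hP'⟩ := h₁
    obtain ⟨Q, hQ, hQ'⟩ := h₂
    refine ⟨P - Q, (Polynomial.natDegree_sub_le _ _).trans ?_,
      fun c => by simp [scalarEval, hP', hQ']⟩
    simp only [mulCount]; omega
  | neg e h =>
    obtain ⟨P, hP, hP'⟩ := h
    exact ⟨-P, by simpa [mulCount] using hP, fun c => by simp [scalarEval, hP']⟩
  | smul k e h =>
    obtain ⟨P, hP, hP'⟩ := h
    exact ⟨Polynomial.C k * P, (Polynomial.natDegree_C_mul_le k P).trans hP,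
      fun c => by simp [scalarEval, hP']⟩
  | mul e₁ e₂ h₁ h₂ =>
    obtain ⟨P, hP, hP'⟩ := h₁
    obtain ⟨Q, hQ, hQ'⟩ := h₂
    refine ⟨P * Q, Polynomial.natDegree_mul_le.trans ?_,
      fun c => by simp [scalarEval, hP', hQ']⟩
    simp only [mulCount]; omega

/-- If an expression is a polynomial of degree `k` in a common factor of all its variables, then
it has at least `k - 1` products. -/
theorem natDegree_le_mulCount_add_one {δ : (a b : Shape) → Datum a b → ℝ} {p q : ℝ}
    {a b : Shape} {e : MatExpr a b} (P : Polynomial ℝ)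
    (h : ∀ c : ℝ, scalarEval (fun a b s => c * δ a b s) (c * p) (c * q) e = P.eval c) :
    P.natDegree ≤ e.mulCount + 1 := by
  obtain ⟨Q, hQ, hQ'⟩ := exists_polynomial_scalarEval δ p q e
  rwa [Polynomial.funext (p := P) (q := Q) fun c => by rw [← h, hQ']]

section LinearForms

variable {E : Type*} [AddCommGroup E] [Module ℝ E] (δ : (a b : Shape) → Datum a b → E →ₗ[ℝ] ℝ)
  (p q : E →ₗ[ℝ] ℝ)

theorem exists_linear_of_mulCount_eq_zero {a b : Shape} (e : MatExpr a b)
    (he : e.mulCount = 0) :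
    ∃ l : E →ₗ[ℝ] ℝ, ∀ y, scalarEval (fun a b s => δ a b s y) (p y) (q y) e = l y := by
  induction e with
  | fst => exact ⟨p, fun _ => rfl⟩
  | snd => exact ⟨q, fun _ => rfl⟩
  | datum s => exact ⟨δ _ _ s, fun _ => rfl⟩
  | zero => exact ⟨0, fun _ => rfl⟩
  | add e₁ e₂ h₁ h₂ =>
    simp only [mulCount, Nat.add_eq_zero_iff] at he
    obtain ⟨l, hl⟩ := h₁ he.1
    obtain ⟨m, hm⟩ := h₂ he.2
    exact ⟨l + m, fun y => by simp [scalarEval, hl, hm]⟩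
  | sub e₁ e₂ h₁ h₂ =>
    simp only [mulCount, Nat.add_eq_zero_iff] at he
    obtain ⟨l, hl⟩ := h₁ he.1
    obtain ⟨m, hm⟩ := h₂ he.2
    exact ⟨l - m, fun y => by simp [scalarEval, hl, hm]⟩
  | neg e h =>
    obtain ⟨l, hl⟩ := h he
    exact ⟨-l, fun y => by simp [scalarEval, hl]⟩
  | smul c e h =>
    obtain ⟨l, hl⟩ := h he
    exact ⟨c • l, fun y => by simp [scalarEval, hl]⟩
  | mul e₁ e₂ => simp [mulCount] at he

/-- An expression with at most one product is, as a function of scalar values that depend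
linearly on `y`, a linear form plus one product of two linear forms. -/
theorem exists_linear_add_mul_of_mulCount_le_one {a b : Shape} (e : MatExpr a b)
    (he : e.mulCount ≤ 1) :
    ∃ l A B : E →ₗ[ℝ] ℝ, ∀ y,
      scalarEval (fun a b s => δ a b s y) (p y) (q y) e = l y + A y * B y := by
  have key := fun {a b : Shape} (e : MatExpr a b) => exists_linear_of_mulCount_eq_zero δ p q e
  induction e with
  | fst => exact ⟨p, 0, 0, fun y => by simp [scalarEval]⟩
  | snd => exact ⟨q, 0, 0, fun y => by simp [scalarEval]⟩
  | datum s => exact ⟨δ _ _ s, 0, 0, fun y => by simp [scalarEval]⟩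
  | zero => exact ⟨0, 0, 0, fun y => by simp [scalarEval]⟩
  | add e₁ e₂ h₁ h₂ =>
    simp only [mulCount] at he
    obtain h | h : e₁.mulCount = 0 ∨ e₂.mulCount = 0 := by omega
    · obtain ⟨m, hm⟩ := key e₁ h
      obtain ⟨l, A, B, hl⟩ := h₂ (by omega)
      exact ⟨m + l, A, B, fun y => by simp [scalarEval, hl, hm]; ring⟩
    · obtain ⟨m, hm⟩ := key e₂ h
      obtain ⟨l, A, B, hl⟩ := h₁ (by omega)
      exact ⟨l + m, A, B, fun y => by simp [scalarEval, hl, hm]; ring⟩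
  | sub e₁ e₂ h₁ h₂ =>
    simp only [mulCount] at he
    obtain h | h : e₁.mulCount = 0 ∨ e₂.mulCount = 0 := by omega
    · obtain ⟨m, hm⟩ := key e₁ h
      obtain ⟨l, A, B, hl⟩ := h₂ (by omega)
      exact ⟨m - l, -A, B, fun y => by simp [scalarEval, hl, hm]; ring⟩
    · obtain ⟨m, hm⟩ := key e₂ h
      obtain ⟨l, A, B, hl⟩ := h₁ (by omega)
      exact ⟨l - m, A, B, fun y => by simp [scalarEval, hl, hm]; ring⟩
  | neg e h =>
    obtain ⟨l, A, B, hl⟩ := h he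
    exact ⟨-l, -A, B, fun y => by simp [scalarEval, hl]; ring⟩
  | smul c e h =>
    obtain ⟨l, A, B, hl⟩ := h he
    exact ⟨c • l, c • A, B, fun y => by simp [scalarEval, hl]; ring⟩
  | mul e₁ e₂ =>
    simp only [mulCount] at he
    obtain ⟨A, hA⟩ := key e₁ (by omega)
    obtain ⟨B, hB⟩ := key e₂ (by omega)
    exact ⟨0, A, B, fun y => by simp [scalarEval, hA, hB]⟩

end LinearForms

/-- The quadratic form `y₀ y₂ - y₁ y₃` has rank four, and the product of two linear forms has rank
at most two. -/
theorem not_linear_add_mul (l A B : (Fin 4 → ℝ) →ₗ[ℝ] ℝ) :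
    ¬ ∀ y, l y + A y * B y = y 0 * y 2 - y 1 * y 3 := by
  intro h
  -- The linear part is odd in `y`, the other terms are even.
  have hAB : ∀ y, A y * B y = y 0 * y 2 - y 1 * y 3 := fun y => by
    have h₁ := h y
    have h₂ := h (-y)
    simp only [map_neg, Pi.neg_apply] at h₂
    linarith
  -- Diagonal, then polarized, coefficients of `A B` as a quadratic form.
  have hd : ∀ i, A (Pi.single i 1) * B (Pi.single i 1) = 0 := fun i => by
    rw [hAB]; fin_cases i <;> simp
  have hp : ∀ i j, A (Pi.single i 1) * B (Pi.single j 1) + A (Pi.single j 1) * B (Pi.single i 1)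
      = (Pi.single i 1 + Pi.single j 1 : Fin 4 → ℝ) 0
          * (Pi.single i 1 + Pi.single j 1 : Fin 4 → ℝ) 2
        - (Pi.single i 1 + Pi.single j 1 : Fin 4 → ℝ) 1
          * (Pi.single i 1 + Pi.single j 1 : Fin 4 → ℝ) 3 := fun i j => by
    rw [← hAB, map_add, map_add]
    linear_combination -hd i - hd j
  have h02 := hp 0 2
  have h13 := hp 1 3
  have h01 := hp 0 1
  have h03 := hp 0 3
  have h0 := hd 0
  simp at h02 h13 h01 h03
  generalize A (Pi.single 0 1) = a₀, A (Pi.single 1 1) = a₁, A (Pi.single 2 1) = a₂,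
    A (Pi.single 3 1) = a₃, B (Pi.single 0 1) = b₀, B (Pi.single 1 1) = b₁,
    B (Pi.single 2 1) = b₂, B (Pi.single 3 1) = b₃ at *
  rcases mul_eq_zero.mp h0 with h | h <;> subst h <;> grind

end MatExpr

/-! ### Lower bounds for the number of products -/

namespace MatExpr

/-- Two expressions have the same value whenever the derivatives in `Z` vanish. -/
def Agree (d nf ng ns : ℕ) (Z : (a b : Shape) → Set (Datum a b)) {a b : Shape}
    (e e' : MatExpr a b) : Prop :=
  ∀ (D : Valuation d nf ng ns) p q, (∀ a b, ∀ s ∈ Z a b, D a b s = 0) →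
    e.eval D p q = e'.eval D p q

variable {d nf ng ns : ℕ} {Z : (a b : Shape) → Set (Datum a b)}

theorem Agree.scalarEval_eq {b : Shape} {e e' : MatExpr .unit b} (h : Agree d nf ng ns Z e e')
    (hd : 0 < d) (hb : 0 < b.size d nf ng ns) (δ : (a b : Shape) → Datum a b → ℝ)
    (hδ : ∀ a b, ∀ s ∈ Z a b, δ a b s = 0) (p q : ℝ) :
    scalarEval δ p q e = scalarEval δ p q e' := by
  have key := h (fun a b s => δ a b s • corner _ _) (fun j => if j.val = 0 then p else 0)
    (fun j => if j.val = 0 then q else 0) fun a b s hs => by simp [hδ a b s hs]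
  rw [eval_smul_corner hd, eval_smul_corner hd] at key
  simpa [corner] using congrFun (congrFun key ⟨0, Nat.one_pos⟩) ⟨0, hb⟩

theorem eval_mul_of_dim_eq_zero (D : Valuation 0 nf ng ns) (p q : Fin 0 → ℝ) {a b : Shape}
    (e₁ : MatExpr a .state) (e₂ : MatExpr .state b) : eval D p q (.mul e₁ e₂) = 0 := by
  ext i j
  exact Matrix.mul_apply.trans (Finset.sum_eq_zero fun k _ => Fin.elim0 k)

/-- If the values of `e'` at the multiples of one point form a polynomial of degree `k`, then every
expression that agrees with `e'` has at least `k - 1` products. -/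
theorem Agree.natDegree_le_mulCount_add_one {b : Shape} {e e' : MatExpr .unit b}
    (h : Agree d nf ng ns Z e e') (hd : 0 < d) (hb : 0 < b.size d nf ng ns)
    (δ : (a b : Shape) → Datum a b → ℝ) (hδ : ∀ a b, ∀ s ∈ Z a b, δ a b s = 0) (p q : ℝ)
    (P : Polynomial ℝ)
    (hP : ∀ c : ℝ, scalarEval (fun a b s => c * δ a b s) (c * p) (c * q) e' = P.eval c) :
    P.natDegree ≤ e.mulCount + 1 :=
  MatExpr.natDegree_le_mulCount_add_one (δ := δ) (p := p) (q := q) P fun c =>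
    (h.scalarEval_eq hd hb _ (fun a b s hs => by simp [hδ a b s hs]) _ _).trans (hP c)

/-- If the derivative `s` is not known to vanish and no dimension is zero, then the second order
method's product with `s` has degree two and takes at least one multiplication; otherwise the first
order method's product with `s` is zero. -/
theorem exists_agree_mul_datum {b : Shape} (s : Datum .state b) {e : MatExpr .unit b}
    (he : Agree d nf ng ns Z e (.mul .fst (.datum s))) :
    ∃ e' : MatExpr .unit b, Agree d nf ng ns Z e' (.mul .snd (.datum s)) ∧
      e'.mulCount ≤ e.mulCount := by
  classical
  by_cases hs : s ∈ Z _ _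
  · exact ⟨.zero, fun D p q hD => by simp [eval, hD _ _ s hs], Nat.zero_le _⟩
  rcases Nat.eq_zero_or_pos d with rfl | hd
  · exact ⟨.zero, fun D p q _ => (eval_mul_of_dim_eq_zero D p q _ _).symm, Nat.zero_le _⟩
  rcases Nat.eq_zero_or_pos (b.size d nf ng ns) with hb | hb
  · exact ⟨.zero, fun D p q _ => by ext i j; exact (Fin.cast hb j).elim0, Nat.zero_le _⟩
  refine ⟨_, fun D p q _ => rfl, ?_⟩
  have := he.natDegree_le_mulCount_add_one hd hb (fun a b s => if s ∈ Z a b then 0 else 1)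
    (fun a b s hs => if_pos hs) 1 0 (.X ^ 2) fun c => by simp [scalarEval, hs, sq]
  rw [Polynomial.natDegree_X_pow] at this
  simp only [mulCount]
  omega

/-- If `d > 0` and neither `∂f/∂x` nor `∂f/∂v` is known to vanish, the right-hand side of the second
order adjoint equation takes at least two products: for `d = 1` and `d/dt (∂f/∂v) = 0` it is
the quadratic form `y₀ y₂ - y₁ y₃` of rank four in the values of `ρ`, `ρ̇`, `∂f/∂x` and `∂f/∂v`. -/
theorem Agree.two_le_mulCount_rhs (hd : 0 < d) (hP : Datum.accPos ∉ Z _ _)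
    (hV : Datum.accVel ∉ Z _ _) {e : MatExpr .unit .state}
    (he : Agree d nf ng ns Z e Scheme.secondOrder.rhs₂) : 2 ≤ e.mulCount := by
  by_contra! hlt
  let π := fun i : Fin 4 => LinearMap.proj (R := ℝ) (φ := fun _ : Fin 4 => ℝ) i
  let δ : (a b : Shape) → Datum a b → (Fin 4 → ℝ) →ₗ[ℝ] ℝ := fun _ _ s => match s with
    | .accPos => π 2
    | .accVel => π 3
    | _ => 0
  obtain ⟨l, A, B, h⟩ :=
    exists_linear_add_mul_of_mulCount_le_one δ (π 0) (π 1) e (Nat.lt_succ_iff.mp hlt)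
  refine not_linear_add_mul l A B fun y => ?_
  rw [← h, he.scalarEval_eq hd hd]
  · simp [Scheme.secondOrder, scalarEval, δ, π]
  · intro a b s hs
    cases s <;> first | exact absurd hs hP | exact absurd hs hV | rfl

/-- The two right-hand sides of the first order adjoint equation can be computed with one product for
each of `∂f/∂x` and `∂f/∂v` that is not known to vanish. If `d > 0`, the second order one takes at
least as many; if only one of the two derivatives can be nonzero, the degree shows it. -/
theorem exists_agree_rhs {e : MatExpr .unit .state}
    (he : Agree d nf ng ns Z e Scheme.secondOrder.rhs₂) :
    ∃ e₁ e₂ : MatExpr .unit .state, Agree d nf ng ns Z e₁ Scheme.firstOrder.rhs₁ ∧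
      Agree d nf ng ns Z e₂ Scheme.firstOrder.rhs₂ ∧
      e₁.mulCount + e₂.mulCount ≤ e.mulCount := by
  rcases Nat.eq_zero_or_pos d with rfl | hd
  · exact ⟨.zero, .zero, fun D p q _ => by ext i j; exact Fin.elim0 j,
      fun D p q _ => by ext i j; exact Fin.elim0 j, Nat.zero_le _⟩
  by_cases hP : Datum.accPos ∈ Z _ _ <;> by_cases hV : Datum.accVel ∈ Z _ _
  · exact ⟨.zero, .neg .fst, fun D p q hD => by simp [Scheme.firstOrder, eval, hD _ _ _ hP],
      fun D p q hD => by simp [Scheme.firstOrder, eval, hD _ _ _ hV], Nat.zero_le _⟩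
  · refine ⟨.zero, _, fun D p q hD => by simp [Scheme.firstOrder, eval, hD _ _ _ hP],
      fun D p q hD => rfl, ?_⟩
    have := he.natDegree_le_mulCount_add_one hd hd
      (fun _ _ s => match s with | .accVel => 1 | _ => 0)
      (fun a b s hs => by cases s <;> first | exact absurd hs hV | rfl) 0 (-1) (.X ^ 2)
      fun c => by simp [Scheme.secondOrder, scalarEval, sq]
    rw [Polynomial.natDegree_X_pow] at this
    simp only [Scheme.firstOrder, mulCount]
    omega
  · refine ⟨_, .neg .fst, fun D p q hD => rfl,
      fun D p q hD => by simp [Scheme.firstOrder, eval, hD _ _ _ hV], ?_⟩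
    have := he.natDegree_le_mulCount_add_one hd hd
      (fun _ _ s => match s with | .accPos => 1 | _ => 0)
      (fun a b s hs => by cases s <;> first | exact absurd hs hP | rfl) 1 0 (.X ^ 2)
      fun c => by simp [Scheme.secondOrder, scalarEval, sq]
    rw [Polynomial.natDegree_X_pow] at this
    simp only [Scheme.firstOrder, mulCount]
    omega
  · exact ⟨_, _, fun D p q hD => rfl, fun D p q hD => rfl, he.two_le_mulCount_rhs hd hP hV⟩

/-- The value of `dL/dθ_s` has degree three in the scalar variables if neither `∂g/∂x` nor `ds/dθ_s`
is known to vanish, and degree two if only `∂g/∂x` is. With `ρ = 0` the second order formula for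
`dL/dθ_s` keeps the term `-ρ̇ᵀ ds/dθ_s`, which shows this in the latter case. -/
theorem exists_agree_gradPos {e : MatExpr .unit .posPar}
    (he : Agree d nf ng ns Z e Scheme.secondOrder.gradPos) :
    ∃ e' : MatExpr .unit .posPar, Agree d nf ng ns Z e' Scheme.firstOrder.gradPos ∧
      e'.mulCount ≤ e.mulCount := by
  by_cases hS : Datum.posPar ∈ Z _ _
  · exact ⟨.zero, fun D p q hD => by simp [Scheme.firstOrder, eval, hD _ _ _ hS], Nat.zero_le _⟩
  rcases Nat.eq_zero_or_pos d with rfl | hd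
  · exact ⟨.zero, fun D p q _ => (eval_mul_of_dim_eq_zero D p q _ _).symm, Nat.zero_le _⟩
  rcases Nat.eq_zero_or_pos ns with rfl | hn
  · exact ⟨.zero, fun D p q _ => by ext i j; exact Fin.elim0 j, Nat.zero_le _⟩
  by_cases hG : Datum.velPos ∈ Z _ _
  · refine ⟨.mul .fst (.datum .posPar),
      fun D p q hD => by simp [Scheme.firstOrder, eval, hD _ _ _ hG], ?_⟩
    have := he.natDegree_le_mulCount_add_one hd hn
      (fun _ _ s => match s with | .posPar => 1 | _ => 0)
      (fun a b s hs => by cases s <;> first | exact absurd hs hS | rfl) 0 (-1) (.X ^ 2)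
      fun c => by simp [Scheme.secondOrder, scalarEval, sq]
    rw [Polynomial.natDegree_X_pow] at this
    simp only [mulCount]
    omega
  · refine ⟨_, fun D p q hD => rfl, ?_⟩
    -- `∂f/∂v = 0` keeps it from cancelling `∂g/∂x`.
    have := he.natDegree_le_mulCount_add_one hd hn
      (fun _ _ s => match s with | .posPar => 1 | .velPos => 1 | _ => 0)
      (fun a b s hs => by
        cases s <;> first | exact absurd hs hS | exact absurd hs hG | rfl) 1 0 (.X ^ 3)
      fun c => by simp [Scheme.secondOrder, scalarEval]; ring
    rw [Polynomial.natDegree_X_pow] at this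
    simp only [Scheme.firstOrder, mulCount]
    omega

end MatExpr

namespace Scheme

theorem AtMost.of_stages {S T : Scheme} (h₁ : S.terminalCount ≤ T.terminalCount)
    (h₂ : S.stepCount ≤ T.stepCount) (h₃ : S.gradAcc.mulCount ≤ T.gradAcc.mulCount)
    (h₄ : S.gradVel.mulCount ≤ T.gradVel.mulCount)
    (h₅ : S.gradPos.mulCount ≤ T.gradPos.mulCount) : S.AtMost T :=
  ⟨h₁, h₂, h₃, h₄, h₅, fun n => by unfold totalCount; gcongr⟩

theorem firstOrder_atMost_secondOrder : firstOrder.AtMost secondOrder := by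
  apply AtMost.of_stages <;> decide

theorem exists_computes_firstOrder_atMost {d nf ng ns : ℕ} {Z : (a b : Shape) → Set (Datum a b)}
    {T : Scheme} (hT : T.Computes d nf ng ns Z secondOrder) :
    ∃ S : Scheme, S.Computes d nf ng ns Z firstOrder ∧ S.AtMost T := by
  obtain ⟨r₁, r₂, hr₁, hr₂, hr⟩ := MatExpr.exists_agree_rhs hT.rhs₂
  obtain ⟨a, ha, ha'⟩ := MatExpr.exists_agree_mul_datum _ hT.gradAcc
  obtain ⟨g, hg, hg'⟩ := MatExpr.exists_agree_mul_datum _ hT.gradVel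
  obtain ⟨s, hs, hs'⟩ := MatExpr.exists_agree_gradPos hT.gradPos
  exact ⟨⟨.datum .lossPos, .datum .lossVel, r₁, r₂, a, g, s⟩,
    ⟨fun _ _ _ _ => rfl, fun _ _ _ _ => rfl, hr₁, hr₂, ha, hg, hs⟩,
    .of_stages (Nat.zero_le _) (hr.trans (Nat.le_add_left _ _)) ha' hg' hs'⟩

end Scheme

end

end SONODE

theorem proposition2 {𝒳 : Type*} {d nf ng ns : ℕ} (M : SONODE.SecondOrderModel 𝒳 d nf ng ns)
    (X₀ : 𝒳) (θf : Fin nf → ℝ) (θg : Fin ng → ℝ) (θs : Fin ns → ℝ)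
    (t₀ tₙ : ℝ) (ht : t₀ < tₙ) (x v : ℝ → Fin d → ℝ)
    (hacc : ContDiff ℝ 1 (fun y : (Fin d → ℝ) × (Fin d → ℝ) × ℝ × (Fin nf → ℝ) =>
      M.acc y.1 y.2.1 y.2.2.1 y.2.2.2))
    (haccVel : ∀ i j, Differentiable ℝ (fun y : (Fin d → ℝ) × (Fin d → ℝ) × ℝ =>
      M.accVel θf y.1 y.2.1 y.2.2 i j))
    (hvel : Differentiable ℝ (fun y : (Fin d → ℝ) × (Fin ng → ℝ) => M.vel y.1 y.2))
    (hpos : Differentiable ℝ (fun θ => M.pos X₀ θ))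
    (hloss : Differentiable ℝ (fun y : (Fin d → ℝ) × (Fin d → ℝ) => M.loss y.1 y.2))
    (htraj : M.IsTrajectory X₀ θf θg θs t₀ tₙ x v) :
    -- `z = [x, v]` solves the coupled first order system
    M.coupled.IsTrajectory X₀ θf (Sum.elim θs θg) t₀ tₙ (SONODE.concat x v) ∧
    -- the total derivative of `∂f/∂v` along the trajectory exists and is given by the chain rule
    (∀ t ∈ Set.Icc t₀ tₙ, ∀ i j,
      HasDerivWithinAt (fun τ => M.accVel θf (x τ) (v τ) τ i j)
        (fderiv ℝ (fun y : (Fin d → ℝ) × (Fin d → ℝ) × ℝ => M.accVel θf y.1 y.2.1 y.2.2 i j)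
          (x t, v t, t) (v t, M.acc (x t) (v t) t θf, 1)) (Set.Icc t₀ tₙ) t) ∧
    -- the second block of the first order adjoint solves the second order adjoint's problem
    (∀ r : ℝ → Fin d ⊕ Fin d → ℝ, M.coupled.IsAdjoint θf t₀ tₙ (SONODE.concat x v) r →
      M.IsAdjoint θf t₀ tₙ x v (fun t => r t ∘ Sum.inr)
        (fun t => -(r t ∘ Sum.inl) - (r t ∘ Sum.inr) ᵥ* M.accVel θf (x t) (v t) t)) ∧
    -- conversely, every second order adjoint arises in this way
    (∀ r w : ℝ → Fin d → ℝ, M.IsAdjoint θf t₀ tₙ x v r w →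
      M.coupled.IsAdjoint θf t₀ tₙ (SONODE.concat x v)
        (SONODE.concat (fun t => -w t - r t ᵥ* M.accVel θf (x t) (v t) t) r)) ∧
    -- the second block is the second order adjoint, and all gradients coincide
    (∀ (r : ℝ → Fin d ⊕ Fin d → ℝ) (ρ w : ℝ → Fin d → ℝ),
      M.coupled.IsAdjoint θf t₀ tₙ (SONODE.concat x v) r → M.IsAdjoint θf t₀ tₙ x v ρ w →
      (∀ t ∈ Set.Icc t₀ tₙ, r t ∘ Sum.inr = ρ t) ∧
      IntervalIntegrable (M.coupled.gradFieldIntegrand θf (SONODE.concat x v) r) MeasureTheory.volume tₙ t₀ ∧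
      IntervalIntegrable (M.gradAccIntegrand θf x v ρ) MeasureTheory.volume tₙ t₀ ∧
      M.coupled.gradField θf t₀ tₙ (SONODE.concat x v) r = M.gradAcc θf t₀ tₙ x v ρ ∧
      M.coupled.gradInit X₀ (Sum.elim θs θg) t₀ r ∘ Sum.inr = M.gradVel θg t₀ x ρ ∧
      M.coupled.gradInit X₀ (Sum.elim θs θg) t₀ r ∘ Sum.inl = M.gradPos X₀ θf θg θs t₀ x v ρ w) ∧
    -- the two schemes whose multiplications are counted are the two adjoint methods
    (∀ r : ℝ → Fin d ⊕ Fin d → ℝ, M.coupled.IsAdjoint θf t₀ tₙ (SONODE.concat x v) r ↔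
      SONODE.Scheme.firstOrder.IsRun (M.valuation X₀ θf θg θs t₀ tₙ x v) t₀ tₙ
        (fun t => r t ∘ Sum.inl) (fun t => r t ∘ Sum.inr)) ∧
    (∀ r : ℝ → Fin d ⊕ Fin d → ℝ,
      (∀ t ∈ Set.Icc t₀ tₙ, M.coupled.gradFieldIntegrand θf (SONODE.concat x v) r t =
        SONODE.Scheme.firstOrder.gradAcc.row (M.valuation X₀ θf θg θs t₀ tₙ x v t) (r t ∘ Sum.inl) (r t ∘ Sum.inr)) ∧
      M.coupled.gradInit X₀ (Sum.elim θs θg) t₀ r ∘ Sum.inr =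
        SONODE.Scheme.firstOrder.gradVel.row (M.valuation X₀ θf θg θs t₀ tₙ x v t₀) (r t₀ ∘ Sum.inl) (r t₀ ∘ Sum.inr) ∧
      M.coupled.gradInit X₀ (Sum.elim θs θg) t₀ r ∘ Sum.inl =
        SONODE.Scheme.firstOrder.gradPos.row (M.valuation X₀ θf θg θs t₀ tₙ x v t₀) (r t₀ ∘ Sum.inl) (r t₀ ∘ Sum.inr)) ∧
    (∀ ρ w : ℝ → Fin d → ℝ, M.IsAdjoint θf t₀ tₙ x v ρ w ↔
      SONODE.Scheme.secondOrder.IsRun (M.valuation X₀ θf θg θs t₀ tₙ x v) t₀ tₙ ρ w) ∧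
    (∀ ρ w : ℝ → Fin d → ℝ,
      (∀ t ∈ Set.Icc t₀ tₙ, M.gradAccIntegrand θf x v ρ t =
        SONODE.Scheme.secondOrder.gradAcc.row (M.valuation X₀ θf θg θs t₀ tₙ x v t) (ρ t) (w t)) ∧
      M.gradVel θg t₀ x ρ = SONODE.Scheme.secondOrder.gradVel.row (M.valuation X₀ θf θg θs t₀ tₙ x v t₀) (ρ t₀) (w t₀) ∧
      M.gradPos X₀ θf θg θs t₀ x v ρ w =
        SONODE.Scheme.secondOrder.gradPos.row (M.valuation X₀ θf θg θs t₀ tₙ x v t₀) (ρ t₀) (w t₀)) ∧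
    -- as written, the first order scheme has at most as many multiplications as the second order
    SONODE.Scheme.firstOrder.AtMost SONODE.Scheme.secondOrder ∧
    -- in general and in every special case in which some of the derivatives vanish, however the
    -- second order method is computed, the first order one can be computed with at most as many
    (∀ (Z : (a b : SONODE.Shape) → Set (SONODE.Datum a b)) (T : SONODE.Scheme),
      T.Computes d nf ng ns Z SONODE.Scheme.secondOrder →
      ∃ S : SONODE.Scheme, S.Computes d nf ng ns Z SONODE.Scheme.firstOrder ∧ S.AtMost T) := by
  have hacc' := hacc.differentiable one_ne_zero
  refine ⟨htraj.coupled, fun t ht i j => htraj.hasDerivWithinAt_accVel (haccVel i j) ht,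
    fun r hr => htraj.isAdjoint_of_coupled hacc haccVel hloss hr,
    fun r w hr => htraj.coupled_isAdjoint_concat hacc haccVel hloss hr,
    fun r ρ w hr hρ => ?_,
    fun r => SONODE.SecondOrderModel.coupled_isAdjoint_iff_isRun hacc' hloss,
    fun r => ⟨fun t _ => SONODE.SecondOrderModel.coupled_gradFieldIntegrand hacc' r t, ?_, ?_⟩,
    fun ρ w => SONODE.SecondOrderModel.isAdjoint_iff_isRun,
    fun ρ w => ⟨fun t _ => rfl, rfl, rfl⟩,
    SONODE.Scheme.firstOrder_atMost_secondOrder,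
    fun Z T hT => SONODE.Scheme.exists_computes_firstOrder_atMost hT⟩
  · have hEq := htraj.eqOn_concat_of_isAdjoint hacc haccVel hloss hr hρ
    have hB : ∀ t ∈ Set.Icc t₀ tₙ, r t ∘ Sum.inr = ρ t := fun t ht => by
      rw [hEq ht]; rfl
    have hint : Set.EqOn (M.coupled.gradFieldIntegrand θf (SONODE.concat x v) r)
        (M.gradAccIntegrand θf x v ρ) (Set.uIcc tₙ t₀) := fun t h => by
      rw [Set.uIcc_of_ge ht.le] at h
      simp only [SONODE.SecondOrderModel.coupled_gradFieldIntegrand hacc',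
        SONODE.SecondOrderModel.gradAccIntegrand, hB t h]
    have hi := htraj.intervalIntegrable_gradAccIntegrand ht hacc
      (fun t h => (hρ.deriv t h).continuousWithinAt)
    have h₀ : t₀ ∈ Set.Icc t₀ tₙ := Set.left_mem_Icc.mpr ht.le
    refine ⟨hB, hi.congr (hint.symm.mono Set.uIoc_subset_uIcc), hi,
      congrArg Neg.neg (intervalIntegral.integral_congr hint), ?_, ?_⟩
    · rw [SONODE.SecondOrderModel.coupled_gradInit hvel hpos, Sum.elim_comp_inr, hB t₀ h₀,
        ← htraj.initial_pos]
      rfl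
    · rw [SONODE.SecondOrderModel.coupled_gradInit hvel hpos, Sum.elim_comp_inl, hB t₀ h₀,
        ← htraj.initial_pos, hEq h₀, SONODE.SecondOrderModel.gradPos]
      congr 1
      simp only [SONODE.concat, Sum.elim_comp_inl]
      abel
  · rw [SONODE.SecondOrderModel.coupled_gradInit hvel hpos, ← htraj.initial_pos]
    rfl
  · rw [SONODE.SecondOrderModel.coupled_gradInit hvel hpos, ← htraj.initial_pos]
    rfl
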